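/- All graphs are finite and simple. For a graph $G$ and $D\subseteq V(G)$, let $N[D]$ be the set of vertices of $D$ together with all their neighbours. The set $D$ is isolating if $G-N[D]$ has no edges, and $\iota(G)$ denotes the size of a smallest isolating set of $G$; an isolating set of size $\iota(G)$ is called minimum. A leaf is a vertex of degree $1$. The family $\mathcal F$ is defined as follows. Take $r\ge 2$ disjoint copies of the path $P_3$ of order $3$, the vertices of each copy being labelled $a,b,c$ in the order of the path, and $s\ge 0$ disjoint copies of the path $P_4$ of order $4$, the vertices of each copy being labelled $x,y,y,x$ in the order of the path. Let $A$ and $X$ be the sets of vertices labelled $a$ and $x$, respectively. A tree belongs to $\mathcal F$ if and only if it can be obtained from such copies by adding edges with both endpoints in $A\cup X$ in such a way that no vertex of $A\cup X$ is a leaf of the resulting tree (equivalently, the leaves of the tree are exactly the vertices labelled $c$). Theorem. Let $T$ be a tree of order $n$ with $\ell$ leaves. (i) If $n\ge 6$, then $\iota(T)=\frac{n+\ell}{4}$ if and only if $T\in\mathcal F$. (ii) If $T\in\mathcal F$, then $\iota(T)=\frac{n+\ell}{4}$. Moreover, for every construction of $T$ as above, $T$ has a minimum isolating set that consists of all the vertices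 in $A$ and exactly one vertex labelled $x$ from each copy of $P_4$. -/

import Mathlib

namespace TreeIsolation

open SimpleGraph
open scoped SimpleGraph

/-- The closed neighbourhood `N[D]`: the vertices of `D` and all their neighbours. -/
def closedNbhd {V : Type*} (G : SimpleGraph V) (D : Set V) : Set V :=
  {v | v ∈ D ∨ ∃ u ∈ D, G.Adj u v}

/-- `D` is `H`-isolating in `G`: no subgraph of `G - N[D]` is a copy of `H`. -/
def IsIsolatingFor {V W : Type*} (H : SimpleGraph W) (G : SimpleGraph V) (D : Set V) : Prop :=
  H.Free (G.induce (closedNbhd G D)ᶜ)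

/-- `D` is isolating in `G`: it is `K₂`-isolating. -/
def IsIsolating {V : Type*} (G : SimpleGraph V) (D : Set V) : Prop :=
  IsIsolatingFor (completeGraph (Fin 2)) G D

/-- The isolation number `ι(G)`: the size of a smallest isolating set. (In a finite graph the set
of all vertices is isolating, so the infimum is attained.) -/
noncomputable def isolationNumber {V : Type*} (G : SimpleGraph V) : ℕ :=
  sInf {k | ∃ D : Finset V, IsIsolating G (D : Set V) ∧ D.card = k}

/-- `D` is a minimum isolating set of `G`. -/
def IsMinimumIsolating {V : Type*} (G : SimpleGraph V) (D : Finset V) : Prop :=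
  IsIsolating G (D : Set V) ∧ D.card = isolationNumber G

/-- `v` is a leaf of `G`: it has degree one. -/
def IsLeaf {V : Type*} (G : SimpleGraph V) (v : V) : Prop :=
  (G.neighborSet v).ncard = 1

/-- The number of leaves of `G`. -/
noncomputable def leafOrder {V : Type*} (G : SimpleGraph V) : ℕ :=
  {v | IsLeaf G v}.ncard

/-- The vertices of `r` disjoint copies of the path of order 3 and `s` disjoint copies of the path
of order 4. In each `P₃` the vertices `0, 1, 2` have labels `a, b, c`; in each `P₄` the vertices
`0, 1, 2, 3` have labels `x, y, y, x`. -/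
abbrev PieceVertex (r s : ℕ) : Type := (Fin r × Fin 3) ⊕ (Fin s × Fin 4)

/-- The disjoint union of `r` copies of `P₃` and `s` copies of `P₄` (the box product of an edgeless
graph with a path is a disjoint union of copies of that path). -/
def pieces (r s : ℕ) : SimpleGraph (PieceVertex r s) :=
  ((⊥ : SimpleGraph (Fin r)) □ pathGraph 3) ⊕g ((⊥ : SimpleGraph (Fin s)) □ pathGraph 4)

/-- The vertices with label `a` or `x`, that is, the set `A ∪ X`. -/
def IsLink {r s : ℕ} : PieceVertex r s → Prop
  | Sum.inl (_, k) => k = 0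
  | Sum.inr (_, k) => k = 0 ∨ k = 3

/-- `T` is a tree obtained from `r ≥ 2` copies of `P₃` and `s ≥ 0` copies of `P₄`, placed on the
vertices of `T` by the bijection `e`, by adding edges with both endpoints in `A ∪ X` so that no
vertex of `A ∪ X` remains a leaf. -/
structure IsConstruction {V : Type*} (T : SimpleGraph V) (r s : ℕ)
    (e : PieceVertex r s ≃ V) : Prop where
  isTree : T.IsTree
  two_le : 2 ≤ r
  adj_of_pieces : ∀ u v, (pieces r s).Adj u v → T.Adj (e u) (e v)
  added_edges : ∀ u v, T.Adj (e u) (e v) → (pieces r s).Adj u v ∨ (IsLink u ∧ IsLink v)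
  not_isLeaf : ∀ u, IsLink u → ¬ IsLeaf T (e u)

/-- The family `𝓕` of trees. -/
def MemFamily {V : Type*} (T : SimpleGraph V) : Prop :=
  ∃ (r s : ℕ) (e : PieceVertex r s ≃ V), IsConstruction T r s e

end TreeIsolation

/-! Every member of the family has isolation number $r+s$. Each edge $bc$ or $yz$ has its closed
neighbourhood inside its piece, so an isolating set meets every piece. Conversely, root the tree at
a vertex labelled $b$ and take all the vertices labelled $a$ together with the end at which each
$P_4$ is entered from the root. A vertex labelled $a$ or $x$ whose inner neighbour is nearer to the
root has an outer neighbour, which is farther away and is therefore the entry of its own piece; so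
all of $A\cup X$ is dominated (`Inner.mem_closedNbhd`). Since $n=3r+4s$ and $\ell=r$, this gives
$4\iota=n+\ell$.

For the converse, induction on $n$ shows that $4\iota\le n+\ell$ holds for every tree, with equality
only for $K_2$ and members of the family (`Bounded`). If every side of every edge is a star centred
at the end of the edge on that side, any single vertex isolates. Otherwise a minimal side that is
not such a star gives an edge $uv$ for which $N[v]$ meets every edge outside the component $S$ of
$T-v$ containing $u$, so $\iota(T)\le\iota(S)+1$. At least three vertices lie outside $S$; four or
more give strict inequality. If they form a path $v,p,w$ and $u$ is not a leaf of $S$, equality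
forces $S$ into the family, and the label of $u$ must be $a$ or $x$: for $b$ or $y$ one vertex can
be saved, since $v$ dominates $u$ (`exists_cover_b`, `exists_cover_y`). The path is then a new
$P_3$. If $u$ is a leaf of $S$, it is removed as well, and equality leaves $P_6$ or a relabelling
that creates a new $P_4$. -/

namespace TreeIsolation

open SimpleGraph

/-! ### Branches and distances in trees -/

section Sides

variable {V : Type*} {T : SimpleGraph V}

/-- The vertices that can be reached from `p` by a walk avoiding `v`. -/
def side (T : SimpleGraph V) (v p : V) : Set V :=
  {w | ∃ q : T.Walk p w, v ∉ q.support}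

theorem mem_side_self {v p : V} (h : v ≠ p) : p ∈ side T v p :=
  ⟨Walk.nil, by simpa using h⟩

theorem notMem_side (v p : V) : v ∉ side T v p := fun ⟨q, hq⟩ => hq q.end_mem_support

theorem mem_side_of_adj {v p w z : V} (hw : w ∈ side T v p) (h : T.Adj w z) (hz : z ≠ v) :
    z ∈ side T v p := by
  obtain ⟨q, hq⟩ := hw
  refine ⟨q.concat h, ?_⟩
  simp [Walk.support_concat, hq, hz.symm]

theorem exists_mem_side (hT : T.Connected) {v w : V} (h : w ≠ v) :
    ∃ p, T.Adj v p ∧ w ∈ side T v p := by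
  obtain ⟨q, hq⟩ := hT.exists_isPath v w
  cases q with
  | nil => exact absurd rfl h
  | cons hp q =>
    rw [Walk.cons_isPath_iff] at hq
    exact ⟨_, hp, q, hq.2⟩

/-- A vertex common to two branches would give a connection from `p` to `p'` avoiding `v`, which
closes a cycle through `v`. -/
theorem side_unique (hT : T.IsAcyclic) {v p p' w : V} (hp : T.Adj v p) (hp' : T.Adj v p')
    (hw : w ∈ side T v p) (hw' : w ∈ side T v p') : p = p' := by
  classical
  obtain ⟨q, hq⟩ := hw
  obtain ⟨q', hq'⟩ := hw'
  have hr : v ∉ (q.append q'.reverse).bypass.support := fun h => by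
    have := Walk.support_bypass_subset_support _ h
    rw [Walk.mem_support_append_iff, Walk.support_reverse, List.mem_reverse] at this
    tauto
  have hpath : (Walk.cons hp (q.append q'.reverse).bypass).IsPath :=
    (Walk.cons_isPath_iff _ _).2 ⟨Walk.bypass_isPath _, hr⟩
  have := hT.eq_snd_of_adj_start hpath hp' (Walk.end_mem_support _)
  simpa using this.symm

theorem eq_of_adj_of_mem_side (hT : T.IsAcyclic) {v p w : V} (hp : T.Adj v p) (hw : T.Adj v w)
    (h : w ∈ side T v p) : w = p :=
  side_unique hT hw hp (mem_side_self hw.ne) h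

theorem not_adj_of_adj_of_adj (hT : T.IsAcyclic) {p w z : V} (hw : T.Adj p w) (hz : T.Adj p z) :
    ¬ T.Adj w z := fun h =>
  h.ne (eq_of_adj_of_mem_side hT hw hz (mem_side_of_adj (mem_side_self hw.ne) h hz.ne')).symm

/-- A walk in the branch at `p` cannot meet `u`, since `p` is the only neighbour of `v` in that
branch; prefixing it with `v` keeps it away from `u`. -/
theorem side_subset_side (hT : T.IsAcyclic) {v p u : V} (hp : T.Adj v p) (hu : T.Adj v u)
    (h : p ≠ u) : side T v p ⊆ side T u v := by
  classical
  rintro w ⟨q, hq⟩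
  refine ⟨Walk.cons hp q, ?_⟩
  rw [Walk.support_cons, List.mem_cons]
  rintro (huv | huq)
  · exact hu.ne huv.symm
  · refine h (eq_of_adj_of_mem_side hT hp hu ⟨q.takeUntil u huq, fun hv => hq ?_⟩).symm
    exact Walk.support_takeUntil_subset_support _ _ hv

theorem mem_side_or (hT : T.IsTree) {u v : V} (h : T.Adj u v) (w : V) :
    w ∈ side T u v ∨ w ∈ side T v u := by
  by_cases hw : w = v
  · subst hw
    exact Or.inl (mem_side_self h.ne)
  · obtain ⟨p, hp, hwp⟩ := exists_mem_side hT.connected hw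
    by_cases hpu : p = u
    · exact Or.inr (hpu ▸ hwp)
    · exact Or.inl (side_subset_side hT.isAcyclic hp h.symm hpu hwp)

theorem notMem_side_of_mem_side (hT : T.IsAcyclic) {u v w : V} (h : T.Adj u v)
    (hw : w ∈ side T u v) : w ∉ side T v u := by
  classical
  rintro ⟨q, hq⟩
  obtain ⟨r, hr⟩ := hw
  have hrb : u ∉ r.bypass.support := fun h' => hr (Walk.support_bypass_subset_support _ h')
  have hpath : (Walk.cons h r.bypass).IsPath :=
    (Walk.cons_isPath_iff _ _).2 ⟨Walk.bypass_isPath _, hrb⟩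
  have := Subtype.mk.inj ((hT.subsingleton_path u w).elim ⟨_, hpath⟩ ⟨_, q.bypass_isPath⟩)
  have hv : v ∈ q.bypass.support := by
    rw [← this]; simp
  exact hq (Walk.support_bypass_subset_support _ hv)

theorem notMem_side_iff (hT : T.IsTree) {u v w : V} (h : T.Adj u v) :
    w ∉ side T v u ↔ w ∈ side T u v :=
  ⟨(mem_side_or hT h w).resolve_right, notMem_side_of_mem_side hT.isAcyclic h⟩

theorem isTree_induce_side (hT : T.IsTree) {v p : V} (h : v ≠ p) :
    (T.induce (side T v p)).IsTree := by
  classical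
  refine ⟨?_, hT.isAcyclic.induce _⟩
  rw [connected_iff_exists_forall_reachable]
  refine ⟨⟨p, mem_side_self h⟩, ?_⟩
  rintro ⟨w, q, hq⟩
  have hmem : ∀ x ∈ q.support, x ∈ side T v p := fun x hx =>
    ⟨q.takeUntil x hx, fun hv => hq (Walk.support_takeUntil_subset_support _ _ hv)⟩
  exact ⟨q.induce _ hmem⟩

/-- Uniqueness of the parent in the tree rooted at `r`: geodesics to two parents would extend to two
different paths from `r` to `v`. -/
theorem eq_of_dist_add_one_eq (hT : T.IsTree) {r v w w' : V} (hw : T.Adj v w) (hw' : T.Adj v w')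
    (h : T.dist r w + 1 = T.dist r v) (h' : T.dist r w' + 1 = T.dist r v) : w = w' := by
  obtain ⟨q, hq⟩ := hT.connected.exists_walk_length_eq_dist r w
  obtain ⟨q', hq'⟩ := hT.connected.exists_walk_length_eq_dist r w'
  have h1 : (q.concat hw.symm).IsPath := Walk.isPath_of_length_eq_dist _ (by
    rw [Walk.length_concat]; omega)
  have h2 : (q'.concat hw'.symm).IsPath := Walk.isPath_of_length_eq_dist _ (by
    rw [Walk.length_concat]; omega)
  have := Subtype.mk.inj ((hT.isAcyclic.subsingleton_path r v).elim ⟨_, h1⟩ ⟨_, h2⟩)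
  have := congrArg Walk.penultimate this
  simpa using this

end Sides

/-! ### Isolating sets and leaves under restriction to a vertex subset -/

section Isolation

variable {V : Type*} {G : SimpleGraph V}

theorem isIsolating_iff {D : Set V} :
    IsIsolating G D ↔ ∀ u v, G.Adj u v → u ∈ closedNbhd G D ∨ v ∈ closedNbhd G D := by
  constructor
  · intro h u v huv
    by_contra! hn
    refine h ⟨⟨⟨![⟨u, hn.1⟩, ⟨v, hn.2⟩], ?_⟩, ?_⟩⟩
    · intro a b hab
      fin_cases a <;> fin_cases b <;> simp_all [huv.symm]
    · intro a b hab
      have := huv.ne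
      fin_cases a <;> fin_cases b <;> simp_all [eq_comm]
  · rintro h ⟨f⟩
    have h01 : (completeGraph (Fin 2)).Adj 0 1 := by simp
    have := f.toHom.map_adj h01
    rcases h _ _ this with h' | h'
    · exact (f 0).2 h'
    · exact (f 1).2 h'

theorem closedNbhd_mono {D E : Set V} (h : D ⊆ E) : closedNbhd G D ⊆ closedNbhd G E := by
  rintro v (hv | ⟨u, hu, huv⟩)
  · exact Or.inl (h hv)
  · exact Or.inr ⟨u, h hu, huv⟩

theorem isolationNumber_le {D : Finset V} (h : IsIsolating G (D : Set V)) :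
    isolationNumber G ≤ D.card :=
  Nat.sInf_le ⟨D, h, rfl⟩

theorem exists_isMinimumIsolating [Fintype V] (G : SimpleGraph V) :
    ∃ D : Finset V, IsMinimumIsolating G D := by
  have : {k | ∃ D : Finset V, IsIsolating G (D : Set V) ∧ D.card = k}.Nonempty :=
    ⟨_, Finset.univ, isIsolating_iff.2 fun u v _ => Or.inl (Or.inl (by simp)), rfl⟩
  exact Nat.sInf_mem this

/-- Here `D` need not isolate the induced graph: edges inside `S` that it misses may be covered by
`E`. This slack is what later saves a vertex. -/
theorem isolationNumber_le_card_add {S : Set V} {D : Finset S} {E : Finset V}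
    (hD : ∀ w z : S, G.Adj w z → w ∈ closedNbhd (G.induce S) D ∨ z ∈ closedNbhd (G.induce S) D ∨
      (w : V) ∈ closedNbhd G E ∨ (z : V) ∈ closedNbhd G E)
    (hE : ∀ w z, G.Adj w z → w ∉ S → w ∈ closedNbhd G E ∨ z ∈ closedNbhd G E) :
    isolationNumber G ≤ D.card + E.card := by
  classical
  have hnb : ∀ w : S, w ∈ closedNbhd (G.induce S) (D : Set S) →
      (w : V) ∈ closedNbhd G ((D.map (Function.Embedding.subtype _) ∪ E : Finset V) : Set V) := by
    rintro w (hw | ⟨u, hu, huw⟩)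
    · exact Or.inl (by simpa using Or.inl hw)
    · exact Or.inr ⟨u, by simpa using Or.inl hu, huw⟩
  have hsub : closedNbhd G (E : Set V) ⊆
      closedNbhd G ((D.map (Function.Embedding.subtype _) ∪ E : Finset V) : Set V) :=
    closedNbhd_mono (by simp)
  refine (isolationNumber_le (D := D.map (Function.Embedding.subtype _) ∪ E) ?_).trans
    ((Finset.card_union_le _ _).trans (by simp))
  rw [isIsolating_iff]
  intro w z hwz
  by_cases hw : w ∈ S
  · by_cases hz : z ∈ S
    · rcases hD ⟨w, hw⟩ ⟨z, hz⟩ hwz with h | h | h | h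
      · exact Or.inl (hnb _ h)
      · exact Or.inr (hnb _ h)
      · exact Or.inl (hsub h)
      · exact Or.inr (hsub h)
    · exact ((hE z w hwz.symm hz).imp (@hsub _) (@hsub _)).symm
  · exact (hE w z hwz hw).imp (@hsub _) (@hsub _)

theorem isolationNumber_le_induce_add [Fintype V] {S : Set V} {E : Finset V}
    (hE : ∀ w z, G.Adj w z → w ∉ S → w ∈ closedNbhd G E ∨ z ∈ closedNbhd G E) :
    isolationNumber G ≤ isolationNumber (G.induce S) + E.card := by
  classical
  obtain ⟨D, hD, hc⟩ := exists_isMinimumIsolating (G.induce S)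
  rw [isIsolating_iff] at hD
  rw [← hc]
  exact isolationNumber_le_card_add
    (fun w z h => (hD w z h).imp id Or.inl) hE

theorem isLeaf_iff {v : V} : IsLeaf G v ↔ ∃ w, ∀ z, G.Adj v z ↔ z = w := by
  unfold IsLeaf
  rw [Set.ncard_eq_one]
  simp [Set.ext_iff]

theorem not_isLeaf_of_adj_of_adj {v w z : V} (hw : G.Adj v w) (hz : G.Adj v z) (h : w ≠ z) :
    ¬ IsLeaf G v := by
  rw [isLeaf_iff]
  rintro ⟨x, hx⟩
  exact h (((hx w).1 hw).trans ((hx z).1 hz).symm)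

theorem isLeaf_of_isLeaf_induce {S : Set V} {w : S} (h : ∀ z, G.Adj w z → z ∈ S)
    (hw : IsLeaf (G.induce S) w) : IsLeaf G w := by
  rw [isLeaf_iff] at hw ⊢
  obtain ⟨x, hx⟩ := hw
  refine ⟨x, fun z => ⟨fun hz => ?_, ?_⟩⟩
  · exact congrArg Subtype.val ((hx ⟨z, h z hz⟩).1 hz)
  · rintro rfl
    exact (hx x).2 rfl

/-- A leaf of the induced graph without neighbours outside `S` is already a leaf of `G`, so it is
counted besides `L`. -/
theorem leafOrder_induce_add_le [Fintype V] {S : Set V} {L : Finset V}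
    (hS : ∀ w : S, IsLeaf (G.induce S) w → ∀ z, G.Adj w z → z ∈ S)
    (hL : ∀ w ∈ L, w ∉ S ∧ IsLeaf G w) :
    leafOrder (G.induce S) + L.card ≤ leafOrder G := by
  unfold leafOrder
  rw [← Set.ncard_image_of_injective _ Subtype.val_injective, ← Set.ncard_coe_finset L,
    ← Set.ncard_union_eq]
  · refine Set.ncard_le_ncard ?_
    rintro v (⟨w, hw, rfl⟩ | hv)
    · exact isLeaf_of_isLeaf_induce (hS w hw) hw
    · exact (hL v hv).2
  · rw [Set.disjoint_left]
    rintro _ ⟨w, hw, rfl⟩ hv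
    exact (hL w hv).1 w.2

/-- Only `u` may have neighbours outside `S`, so at most one leaf of the induced graph fails to be a
leaf of `G`; this is the extra one. -/
theorem leafOrder_induce_add_le_add_one [Fintype V] {S : Set V} {L : Finset V} (u : V)
    (hS : ∀ w : S, (w : V) ≠ u → ∀ z, G.Adj w z → z ∈ S)
    (hL : ∀ w ∈ L, w ∉ S ∧ IsLeaf G w) :
    leafOrder (G.induce S) + L.card ≤ leafOrder G + 1 := by
  unfold leafOrder
  rw [← Set.ncard_image_of_injective _ Subtype.val_injective, ← Set.ncard_coe_finset L,
    ← Set.ncard_union_eq]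
  · refine le_trans (Set.ncard_le_ncard (t := insert u {v | IsLeaf G v}) ?_)
      (Set.ncard_insert_le _ _)
    rintro v (⟨w, hw, rfl⟩ | hv)
    · by_cases hwu : (w : V) = u
      · exact Or.inl hwu
      · exact Or.inr (isLeaf_of_isLeaf_induce (hS w hwu) hw)
    · exact Or.inr (hL v hv).2
  · rw [Set.disjoint_left]
    rintro _ ⟨w, hw, rfl⟩ hv
    exact (hL w hv).1 w.2

theorem two_le_leafOrder [Fintype V] (hG : G.IsTree) (h : 2 ≤ Fintype.card V) :
    2 ≤ leafOrder G := by
  classical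
  have : Nontrivial V := Fintype.one_lt_card_iff_nontrivial.1 h
  obtain ⟨u, v, huv, hu, hv⟩ := hG.exists_ne_and_degree_eq_one
  have key : ∀ w, G.degree w = 1 → IsLeaf G w := by
    intro w hw
    unfold IsLeaf
    rw [Set.ncard_eq_toFinset_card', ← hw]
    rfl
  rw [← Set.ncard_pair huv]
  refine Set.ncard_le_ncard ?_
  rintro w (rfl | rfl)
  · exact key _ hu
  · exact key _ hv

end Isolation

/-! ### Labelled trees and domination by entry vertices -/

/-- A placement of copies of `P₃`, indexed by `R`, and of `P₄`, indexed by `S`, on the vertices of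
`T` such that the vertices labelled `b`, `c`, `y` have no further neighbours and the vertices
labelled `a`, `x` have a further neighbour. The vertices of a `P₄` are called `x, y, z, t`. -/
structure Labelling {V : Type*} (T : SimpleGraph V) (R S : Type) where
  place : (R × Fin 3) ⊕ (S × Fin 4) → V
  bijective : Function.Bijective place
  adj_b : ∀ i w, T.Adj (place (.inl (i, 1))) w ↔
    w = place (.inl (i, 0)) ∨ w = place (.inl (i, 2))
  adj_c : ∀ i w, T.Adj (place (.inl (i, 2))) w ↔ w = place (.inl (i, 1))
  adj_y : ∀ j w, T.Adj (place (.inr (j, 1))) w ↔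
    w = place (.inr (j, 0)) ∨ w = place (.inr (j, 2))
  adj_z : ∀ j w, T.Adj (place (.inr (j, 2))) w ↔
    w = place (.inr (j, 1)) ∨ w = place (.inr (j, 3))
  exists_a : ∀ i, ∃ w, T.Adj (place (.inl (i, 0))) w ∧ w ≠ place (.inl (i, 1))
  exists_x : ∀ j, ∃ w, T.Adj (place (.inr (j, 0))) w ∧ w ≠ place (.inr (j, 1))
  exists_t : ∀ j, ∃ w, T.Adj (place (.inr (j, 3))) w ∧ w ≠ place (.inr (j, 2))

namespace Labelling

variable {V : Type*} {T : SimpleGraph V} {R S : Type} (L : Labelling T R S)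

abbrev a (i : R) : V := L.place (.inl (i, 0))
abbrev b (i : R) : V := L.place (.inl (i, 1))
abbrev c (i : R) : V := L.place (.inl (i, 2))
abbrev x (j : S) : V := L.place (.inr (j, 0))
abbrev y (j : S) : V := L.place (.inr (j, 1))
abbrev z (j : S) : V := L.place (.inr (j, 2))
abbrev t (j : S) : V := L.place (.inr (j, 3))

theorem cover (v : V) : (∃ i, v = L.a i) ∨ (∃ i, v = L.b i) ∨ (∃ i, v = L.c i) ∨
    (∃ j, v = L.x j) ∨ (∃ j, v = L.y j) ∨ (∃ j, v = L.z j) ∨ (∃ j, v = L.t j) := by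
  obtain ⟨⟨i, k⟩ | ⟨j, k⟩, rfl⟩ := L.bijective.2 v
  · fin_cases k
    · exact Or.inl ⟨i, rfl⟩
    · exact Or.inr (Or.inl ⟨i, rfl⟩)
    · exact Or.inr (Or.inr (Or.inl ⟨i, rfl⟩))
  · fin_cases k
    · exact Or.inr (Or.inr (Or.inr (Or.inl ⟨j, rfl⟩)))
    · exact Or.inr (Or.inr (Or.inr (Or.inr (Or.inl ⟨j, rfl⟩))))
    · exact Or.inr (Or.inr (Or.inr (Or.inr (Or.inr (Or.inl ⟨j, rfl⟩)))))
    · exact Or.inr (Or.inr (Or.inr (Or.inr (Or.inr (Or.inr ⟨j, rfl⟩)))))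

theorem place_eq_iff {u v} : L.place u = L.place v ↔ u = v := L.bijective.1.eq_iff

theorem adj_a_b (i : R) : T.Adj (L.a i) (L.b i) := ((L.adj_b i _).2 (Or.inl rfl)).symm
theorem adj_x_y (j : S) : T.Adj (L.x j) (L.y j) := ((L.adj_y j _).2 (Or.inl rfl)).symm
theorem adj_t_z (j : S) : T.Adj (L.t j) (L.z j) := ((L.adj_z j _).2 (Or.inr rfl)).symm
theorem adj_y_z (j : S) : T.Adj (L.y j) (L.z j) := (L.adj_y j _).2 (Or.inr rfl)

/-- `v` has label `a` or `x` and `p` is its neighbour in its piece. -/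
def Inner (v p : V) : Prop :=
  (∃ i, v = L.a i ∧ p = L.b i) ∨ (∃ j, v = L.x j ∧ p = L.y j) ∨ (∃ j, v = L.t j ∧ p = L.z j)

variable {L}

theorem Inner.adj {v p : V} (h : L.Inner v p) : T.Adj v p := by
  rcases h with ⟨i, rfl, rfl⟩ | ⟨i, rfl, rfl⟩ | ⟨i, rfl, rfl⟩
  · exact L.adj_a_b i
  · exact L.adj_x_y i
  · exact L.adj_t_z i

theorem Inner.exists_adj {v p : V} (h : L.Inner v p) : ∃ w, T.Adj v w ∧ w ≠ p := by
  rcases h with ⟨i, rfl, rfl⟩ | ⟨i, rfl, rfl⟩ | ⟨i, rfl, rfl⟩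
  · exact L.exists_a i
  · exact L.exists_x i
  · exact L.exists_t i

theorem Inner.ne {v p w q : V} (h : L.Inner v p) (h' : L.Inner w q) : v ≠ q := by
  rcases h with ⟨i, rfl, rfl⟩ | ⟨i, rfl, rfl⟩ | ⟨i, rfl, rfl⟩ <;>
  rcases h' with ⟨k, rfl, rfl⟩ | ⟨k, rfl, rfl⟩ | ⟨k, rfl, rfl⟩ <;>
  simp [L.place_eq_iff]

theorem Inner.exists_inner {v p w : V} (h : L.Inner v p) (hw : T.Adj v w) (hne : w ≠ p) :
    ∃ q, L.Inner w q := by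
  rcases L.cover w with ⟨k, rfl⟩ | ⟨k, rfl⟩ | ⟨k, rfl⟩ | ⟨k, rfl⟩ | ⟨k, rfl⟩ | ⟨k, rfl⟩ | ⟨k, rfl⟩
  · exact ⟨_, Or.inl ⟨k, rfl, rfl⟩⟩
  · have := (L.adj_b k v).1 hw.symm
    rcases h with ⟨i, rfl, rfl⟩ | ⟨i, rfl, rfl⟩ | ⟨i, rfl, rfl⟩ <;>
    simp [L.place_eq_iff] at this hne
    exact absurd this.symm hne
  · have := (L.adj_c k v).1 hw.symm
    rcases h with ⟨i, rfl, rfl⟩ | ⟨i, rfl, rfl⟩ | ⟨i, rfl, rfl⟩ <;>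
    simp [L.place_eq_iff] at this hne
  · exact ⟨_, Or.inr (Or.inl ⟨k, rfl, rfl⟩)⟩
  · have := (L.adj_y k v).1 hw.symm
    rcases h with ⟨i, rfl, rfl⟩ | ⟨i, rfl, rfl⟩ | ⟨i, rfl, rfl⟩ <;>
    simp [L.place_eq_iff] at this hne
    exact absurd this.symm hne
  · have := (L.adj_z k v).1 hw.symm
    rcases h with ⟨i, rfl, rfl⟩ | ⟨i, rfl, rfl⟩ | ⟨i, rfl, rfl⟩ <;>
    simp [L.place_eq_iff] at this hne
    exact absurd this.symm hne
  · exact ⟨_, Or.inr (Or.inr ⟨k, rfl, rfl⟩)⟩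

/-- If the piece of `v` is entered, from `r`, elsewhere than at `v`, then some neighbour of `v` is
the vertex at which its own piece is entered. -/
theorem Inner.exists_adj_dist (hT : T.IsTree) (r : V) {v p : V} (h : L.Inner v p)
    (hd : T.dist r p ≠ T.dist r v + 1) :
    ∃ w q, T.Adj v w ∧ L.Inner w q ∧ T.dist r q = T.dist r w + 1 := by
  obtain ⟨w, hw, hne⟩ := h.exists_adj
  obtain ⟨q, hq⟩ := h.exists_inner hw hne
  refine ⟨w, q, hw, hq, ?_⟩
  have hp := (hT.dist_eq_dist_add_one_of_adj r h.adj).resolve_right hd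
  -- The parent of `v` is `p`, so `w` is a child of `v`; then `v` is the parent of `w`, and `q` must
  -- be a child of `w`.
  have hvw : T.dist r w = T.dist r v + 1 := by
    refine (hT.dist_eq_dist_add_one_of_adj r hw).resolve_left fun h' => hne ?_
    exact eq_of_dist_add_one_eq hT hw h.adj h'.symm hp.symm
  refine (hT.dist_eq_dist_add_one_of_adj r hq.adj).resolve_left fun h' => h.ne hq ?_
  exact eq_of_dist_add_one_eq hT hw.symm hq.adj hvw.symm h'.symm

/-- A $P_4$ is not entered at both ends: whichever of `y`, `z` is farther from `r` would have two
parents. -/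
theorem not_and_dist (hT : T.IsTree) (r : V) (j : S) :
    ¬ (T.dist r (L.y j) = T.dist r (L.x j) + 1 ∧ T.dist r (L.z j) = T.dist r (L.t j) + 1) := by
  rintro ⟨h1, h2⟩
  rcases hT.dist_eq_dist_add_one_of_adj r (L.adj_y_z j) with h | h
  · have := eq_of_dist_add_one_eq hT (L.adj_x_y j).symm (L.adj_y_z j) h1.symm h.symm
    simp [L.place_eq_iff] at this
  · have := eq_of_dist_add_one_eq hT (L.adj_t_z j).symm (L.adj_y_z j).symm h2.symm h.symm
    simp [L.place_eq_iff] at this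

variable (L)

open Classical in
/-- The end of the `j`-th `P₄` at which this copy is entered from `r`. -/
noncomputable def entry (r : V) (j : S) : Fin 4 :=
  if T.dist r (L.y j) = T.dist r (L.x j) + 1 then 0 else 3

theorem entry_eq (r : V) (j : S) : L.entry r j = 0 ∨ L.entry r j = 3 := by
  unfold entry; split_ifs <;> simp

theorem entry_inner (r : V) (j : S) :
    ∃ q, L.Inner (L.place (.inr (j, L.entry r j))) q ∧ (q = L.y j ∨ q = L.z j) := by
  rcases L.entry_eq r j with h | h <;> rw [h]
  · exact ⟨L.y j, Or.inr (Or.inl ⟨j, rfl, rfl⟩), Or.inl rfl⟩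
  · exact ⟨L.z j, Or.inr (Or.inr ⟨j, rfl, rfl⟩), Or.inr rfl⟩

variable {L}

theorem Inner.eq_of_dist (hT : T.IsTree) (r : V) {v p : V} (h : L.Inner v p)
    (hd : T.dist r p = T.dist r v + 1) :
    (∃ i, v = L.a i ∧ T.dist r (L.b i) ≠ 0) ∨
    (∃ j, v = L.place (.inr (j, L.entry r j)) ∧ r ≠ L.y j) := by
  rcases h with ⟨i, rfl, rfl⟩ | ⟨j, rfl, rfl⟩ | ⟨j, rfl, rfl⟩
  · exact Or.inl ⟨i, rfl, by omega⟩
  · refine Or.inr ⟨j, by rw [entry, if_pos hd], ?_⟩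
    rintro rfl
    simp at hd
  · refine Or.inr ⟨j, ?_, ?_⟩
    · rw [entry, if_neg fun h => L.not_and_dist hT r j ⟨h, hd⟩]
    · rintro rfl
      have h1 : T.dist (L.y j) (L.z j) = 1 := dist_eq_one_iff_adj.2 (L.adj_y_z j)
      have h2 : T.dist (L.y j) (L.t j) = 0 := by omega
      rw [hT.connected.dist_eq_zero_iff] at h2
      simp [L.place_eq_iff] at h2

/-- A set that contains, for all pieces not containing `r`, the vertex at which the piece is
entered from `r`, dominates all vertices labelled `a` or `x`. -/
theorem Inner.mem_closedNbhd (hT : T.IsTree) (r : V) {D : Set V}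
    (ha : ∀ i, r ≠ L.b i → L.a i ∈ D)
    (hx : ∀ j, r ≠ L.y j → L.place (.inr (j, L.entry r j)) ∈ D)
    {v p : V} (h : L.Inner v p) : v ∈ closedNbhd T D := by
  have key : ∀ w q, L.Inner w q → T.dist r q = T.dist r w + 1 → w ∈ D := by
    intro w q hw hd
    rcases hw.eq_of_dist hT r hd with ⟨i, rfl, hi⟩ | ⟨j, rfl, hj⟩
    · refine ha i ?_
      rintro rfl
      simp at hi
    · exact hx j hj
  by_cases hd : T.dist r p = T.dist r v + 1
  · exact Or.inl (key v p h hd)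
  · obtain ⟨w, q, hvw, hq, hd'⟩ := h.exists_adj_dist hT r hd
    exact Or.inr ⟨w, key w q hq hd', hvw.symm⟩

/-- All edges except the one avoiding the vertices labelled `a`, `x` in the piece of `r` meet the
closed neighbourhood. -/
theorem covers (hT : T.IsTree) (r : V) {D : Set V}
    (ha : ∀ i, r ≠ L.b i → L.a i ∈ D)
    (hx : ∀ j, r ≠ L.y j → L.place (.inr (j, L.entry r j)) ∈ D)
    {u v : V} (h : T.Adj u v) : u ∈ closedNbhd T D ∨ v ∈ closedNbhd T D ∨
      (∃ i, r = L.b i ∧ s(u, v) = s(L.b i, L.c i)) ∨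
      (∃ j, r = L.y j ∧ s(u, v) = s(L.y j, L.z j)) := by
  have hin : ∀ {v p}, L.Inner v p → v ∈ closedNbhd T D := fun h => h.mem_closedNbhd hT r ha hx
  have hbc : ∀ i, L.b i ∈ closedNbhd T D ∨ r = L.b i := fun i => by
    by_cases hr : r = L.b i
    · exact Or.inr hr
    · exact Or.inl (Or.inr ⟨_, ha i hr, L.adj_a_b i⟩)
  have hyz : ∀ j, L.y j ∈ closedNbhd T D ∨ L.z j ∈ closedNbhd T D ∨ r = L.y j := fun j => by
    by_cases hr : r = L.y j
    · exact Or.inr (Or.inr hr)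
    · obtain ⟨q, hq, rfl | rfl⟩ := L.entry_inner r j
      · exact Or.inl (Or.inr ⟨_, hx j hr, hq.adj⟩)
      · exact Or.inr (Or.inl (Or.inr ⟨_, hx j hr, hq.adj⟩))
  rcases L.cover u with ⟨k, rfl⟩ | ⟨k, rfl⟩ | ⟨k, rfl⟩ | ⟨k, rfl⟩ | ⟨k, rfl⟩ | ⟨k, rfl⟩ | ⟨k, rfl⟩
  · exact Or.inl (hin (Or.inl ⟨k, rfl, rfl⟩))
  · rcases (L.adj_b k v).1 h with rfl | rfl
    · exact Or.inr (Or.inl (hin (Or.inl ⟨k, rfl, rfl⟩)))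
    · rcases hbc k with h' | h'
      · exact Or.inl h'
      · exact Or.inr (Or.inr (Or.inl ⟨k, h', rfl⟩))
  · obtain rfl := (L.adj_c k v).1 h
    rcases hbc k with h' | h'
    · exact Or.inr (Or.inl h')
    · exact Or.inr (Or.inr (Or.inl ⟨k, h', Sym2.eq_swap⟩))
  · exact Or.inl (hin (Or.inr (Or.inl ⟨k, rfl, rfl⟩)))
  · rcases (L.adj_y k v).1 h with rfl | rfl
    · exact Or.inr (Or.inl (hin (Or.inr (Or.inl ⟨k, rfl, rfl⟩))))
    · rcases hyz k with h' | h' | h'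
      · exact Or.inl h'
      · exact Or.inr (Or.inl h')
      · exact Or.inr (Or.inr (Or.inr ⟨k, h', rfl⟩))
  · rcases (L.adj_z k v).1 h with rfl | rfl
    · rcases hyz k with h' | h' | h'
      · exact Or.inr (Or.inl h')
      · exact Or.inl h'
      · exact Or.inr (Or.inr (Or.inr ⟨k, h', Sym2.eq_swap⟩))
    · exact Or.inr (Or.inl (hin (Or.inr (Or.inr ⟨k, rfl, rfl⟩))))
  · exact Or.inl (hin (Or.inr (Or.inr ⟨k, rfl, rfl⟩)))

end Labelling

/-! ### From constructions to labellings -/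

theorem exists_adj_ne_of_not_isLeaf {V : Type*} {G : SimpleGraph V} {v p : V} (h : G.Adj v p)
    (hv : ¬ IsLeaf G v) : ∃ w, G.Adj v w ∧ w ≠ p := by
  by_contra! hn
  exact hv (isLeaf_iff.2 ⟨p, fun z => ⟨hn z, fun hz => hz ▸ h⟩⟩)

theorem pieces_adj_inl {r s : ℕ} {i i' : Fin r} {k k' : Fin 3} :
    (pieces r s).Adj (.inl (i, k)) (.inl (i', k')) ↔
      i = i' ∧ (k.val + 1 = k'.val ∨ k'.val + 1 = k.val) := by
  simp [pieces, boxProd_adj, pathGraph_adj, and_comm]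

theorem pieces_adj_inr {r s : ℕ} {i i' : Fin s} {k k' : Fin 4} :
    (pieces r s).Adj (.inr (i, k)) (.inr (i', k')) ↔
      i = i' ∧ (k.val + 1 = k'.val ∨ k'.val + 1 = k.val) := by
  simp [pieces, boxProd_adj, pathGraph_adj, and_comm]

theorem pieces_adj_of_not_isLink {V : Type*} {T : SimpleGraph V} {r s : ℕ}
    {e : PieceVertex r s ≃ V} (h : IsConstruction T r s e) {u : PieceVertex r s}
    (hu : ¬ IsLink u) (w : V) :
    T.Adj (e u) w ↔ (pieces r s).Adj u (e.symm w) := by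
  obtain ⟨v, rfl⟩ := e.surjective w
  rw [Equiv.symm_apply_apply]
  exact ⟨fun hw => (h.added_edges u v hw).resolve_right fun h' => hu h'.1, h.adj_of_pieces u v⟩

/-- The labelling given by a construction. -/
def IsConstruction.labelling {V : Type*} {T : SimpleGraph V} {r s : ℕ}
    {e : PieceVertex r s ≃ V} (h : IsConstruction T r s e) : Labelling T (Fin r) (Fin s) where
  place := e
  bijective := e.bijective
  adj_b i w := by
    rw [pieces_adj_of_not_isLink h (by simp [IsLink])]
    obtain ⟨⟨i', k⟩ | ⟨j, k⟩, rfl⟩ := e.surjective w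
    · simp only [Equiv.symm_apply_apply, pieces_adj_inl, e.apply_eq_iff_eq]
      fin_cases k <;> simp [eq_comm]
    · simp [pieces]
  adj_c i w := by
    rw [pieces_adj_of_not_isLink h (by simp [IsLink])]
    obtain ⟨⟨i', k⟩ | ⟨j, k⟩, rfl⟩ := e.surjective w
    · simp only [Equiv.symm_apply_apply, pieces_adj_inl, e.apply_eq_iff_eq]
      fin_cases k <;> simp [eq_comm]
    · simp [pieces]
  adj_y i w := by
    rw [pieces_adj_of_not_isLink h (by simp [IsLink])]
    obtain ⟨⟨i', k⟩ | ⟨j, k⟩, rfl⟩ := e.surjective w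
    · simp [pieces]
    · simp only [Equiv.symm_apply_apply, pieces_adj_inr, e.apply_eq_iff_eq]
      fin_cases k <;> simp [eq_comm]
  adj_z i w := by
    rw [pieces_adj_of_not_isLink h (by simp [IsLink])]
    obtain ⟨⟨i', k⟩ | ⟨j, k⟩, rfl⟩ := e.surjective w
    · simp [pieces]
    · simp only [Equiv.symm_apply_apply, pieces_adj_inr, e.apply_eq_iff_eq]
      fin_cases k <;> simp [eq_comm]
  exists_a i := exists_adj_ne_of_not_isLeaf
    (h.adj_of_pieces _ _ (by simp [pieces_adj_inl])) (h.not_isLeaf _ (by simp [IsLink]))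
  exists_x i := exists_adj_ne_of_not_isLeaf
    (h.adj_of_pieces _ _ (by simp [pieces_adj_inr])) (h.not_isLeaf _ (by simp [IsLink]))
  exists_t i := exists_adj_ne_of_not_isLeaf
    (h.adj_of_pieces _ _ (by simp [pieces_adj_inr])) (h.not_isLeaf _ (by simp [IsLink]))

/-! ### The isolation number of a labelled tree, and back to constructions -/

namespace Labelling

variable {V : Type*} {T : SimpleGraph V} {R S : Type}

theorem not_isLeaf_of_inner (L : Labelling T R S) {v p : V} (h : L.Inner v p) : ¬ IsLeaf T v := by
  obtain ⟨w, hw, hne⟩ := h.exists_adj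
  exact not_isLeaf_of_adj_of_adj hw h.adj hne

theorem isLeaf_iff_eq_c (L : Labelling T R S) {v : V} : IsLeaf T v ↔ ∃ i, v = L.c i := by
  constructor
  · intro h
    rcases L.cover v with ⟨k, rfl⟩ | ⟨k, rfl⟩ | h | ⟨k, rfl⟩ | ⟨k, rfl⟩ | ⟨k, rfl⟩ | ⟨k, rfl⟩
    · exact absurd h (L.not_isLeaf_of_inner (Or.inl ⟨k, rfl, rfl⟩))
    · refine absurd h (not_isLeaf_of_adj_of_adj ((L.adj_b k _).2 (Or.inl rfl))
        ((L.adj_b k _).2 (Or.inr rfl)) ?_)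
      simp [L.place_eq_iff]
    · exact h
    · exact absurd h (L.not_isLeaf_of_inner (Or.inr (Or.inl ⟨k, rfl, rfl⟩)))
    · refine absurd h (not_isLeaf_of_adj_of_adj ((L.adj_y k _).2 (Or.inl rfl))
        ((L.adj_y k _).2 (Or.inr rfl)) ?_)
      simp [L.place_eq_iff]
    · refine absurd h (not_isLeaf_of_adj_of_adj ((L.adj_z k _).2 (Or.inl rfl))
        ((L.adj_z k _).2 (Or.inr rfl)) ?_)
      simp [L.place_eq_iff]
    · exact absurd h (L.not_isLeaf_of_inner (Or.inr (Or.inr ⟨k, rfl, rfl⟩)))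
  · rintro ⟨i, rfl⟩
    exact isLeaf_iff.2 ⟨_, L.adj_c i⟩

theorem isIsolating_entry (L : Labelling T R S) (hT : T.IsTree) {i₀ : R} {D : Set V}
    (ha : ∀ i, L.a i ∈ D)
    (hx : ∀ j, L.place (.inr (j, L.entry (L.b i₀) j)) ∈ D) : IsIsolating T D := by
  rw [isIsolating_iff]
  intro u v h
  rcases L.covers hT (L.b i₀) (fun i _ => ha i) (fun j _ => hx j) h with
    h | h | ⟨i, -, h⟩ | ⟨j, h, -⟩
  · exact Or.inl h
  · exact Or.inr h
  · have hb : L.b i ∈ closedNbhd T D := Or.inr ⟨_, ha i, L.adj_a_b i⟩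
    rcases Sym2.eq_iff.1 h with ⟨rfl, rfl⟩ | ⟨rfl, rfl⟩
    · exact Or.inl hb
    · exact Or.inr hb
  · simp [L.place_eq_iff] at h

theorem leafOrder_eq [Fintype R] (L : Labelling T R S) : leafOrder T = Fintype.card R := by
  have : {v | IsLeaf T v} = Set.range L.c := by
    ext v
    simp [L.isLeaf_iff_eq_c, eq_comm]
  rw [leafOrder, this, ← Set.image_univ, Set.ncard_image_of_injective, Set.ncard_univ,
    Nat.card_eq_fintype_card]
  intro i j h
  simpa [L.place_eq_iff] using h

variable [Fintype R] [Fintype S]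

theorem card_eq (L : Labelling T R S) [Fintype V] :
    Fintype.card V = 3 * Fintype.card R + 4 * Fintype.card S := by
  rw [← Fintype.card_of_bijective L.bijective]
  simp [mul_comm]

/-- The edges $bc$ and $yz$ can only be covered by a vertex of their own piece, and the pieces are
disjoint. -/
theorem le_card_of_isIsolating (L : Labelling T R S) {D : Finset V} (h : IsIsolating T (D : Set V)) :
    Fintype.card R + Fintype.card S ≤ D.card := by
  rw [isIsolating_iff] at h
  have hR : ∀ i, ∃ k, L.place (.inl (i, k)) ∈ D := by
    intro i
    rcases h _ _ ((L.adj_c i _).2 rfl) with (h | ⟨w, h, hw⟩) | (h | ⟨w, h, hw⟩)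
    · exact ⟨_, h⟩
    · rw [(L.adj_c i w).1 hw.symm] at h
      exact ⟨_, h⟩
    · exact ⟨_, h⟩
    · rcases (L.adj_b i w).1 hw.symm with rfl | rfl <;> exact ⟨_, h⟩
  have hS : ∀ j, ∃ k, L.place (.inr (j, k)) ∈ D := by
    intro j
    rcases h _ _ (L.adj_y_z j) with (h | ⟨w, h, hw⟩) | (h | ⟨w, h, hw⟩)
    · exact ⟨_, h⟩
    · rcases (L.adj_y j w).1 hw.symm with rfl | rfl <;> exact ⟨_, h⟩
    · exact ⟨_, h⟩
    · rcases (L.adj_z j w).1 hw.symm with rfl | rfl <;> exact ⟨_, h⟩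
  choose f hf using hR
  choose g hg using hS
  rw [← Fintype.card_sum, ← Fintype.card_coe]
  refine Fintype.card_le_of_injective
    (Sum.elim (fun i => (⟨_, hf i⟩ : D)) (fun j => ⟨_, hg j⟩)) ?_
  rintro (i | i) (j | j) hij <;> simp [L.place_eq_iff] at hij
  · rw [hij.1]
  · rw [hij.1]

theorem card_le_isolationNumber (L : Labelling T R S) [Fintype V] :
    Fintype.card R + Fintype.card S ≤ isolationNumber T := by
  obtain ⟨D, hD, hc⟩ := exists_isMinimumIsolating T
  exact hc ▸ L.le_card_of_isIsolating hD

theorem exists_finset (L : Labelling T R S) [Fintype V] (r : V) :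
    ∃ D : Finset V, (D : Set V) = {v | ∃ i, v = L.a i} ∪
      {v | ∃ j, v = L.place (.inr (j, L.entry r j))} ∧
      D.card ≤ Fintype.card R + Fintype.card S := by
  classical
  refine ⟨Finset.univ.image L.a ∪
    Finset.univ.image fun j => L.place (.inr (j, L.entry r j)), ?_, ?_⟩
  · ext v
    simp [eq_comm]
  · exact (Finset.card_union_le _ _).trans
      (add_le_add Finset.card_image_le Finset.card_image_le)

theorem isolationNumber_eq (L : Labelling T R S) [Fintype V] [Nonempty R] (hT : T.IsTree) :
    isolationNumber T = Fintype.card R + Fintype.card S := by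
  obtain ⟨D, hD, hc⟩ := L.exists_finset (L.b (Classical.arbitrary R))
  refine le_antisymm ((isolationNumber_le (L.isIsolating_entry hT (i₀ := Classical.arbitrary R)
    (fun i => ?_) fun j => ?_)).trans hc) L.card_le_isolationNumber
  · rw [hD]; exact Or.inl ⟨i, rfl⟩
  · rw [hD]; exact Or.inr ⟨j, rfl⟩

/-- One vertex per piece other than that of `b i₀` suffices
to cover all edges except `b i₀, c i₀`. -/
theorem exists_cover_b (L : Labelling T R S) (hT : T.IsTree) (i₀ : R) :
    ∃ D : Finset V, D.card + 1 ≤ Fintype.card R + Fintype.card S ∧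
      ∀ u v, T.Adj u v → u ∈ closedNbhd T D ∨ v ∈ closedNbhd T D ∨
        s(u, v) = s(L.b i₀, L.c i₀) := by
  classical
  refine ⟨(Finset.univ.erase i₀).image L.a ∪
    Finset.univ.image fun j => L.place (.inr (j, L.entry (L.b i₀) j)), ?_, fun u v h => ?_⟩
  · have h1 := Finset.card_union_le ((Finset.univ.erase i₀).image L.a)
      (Finset.univ.image fun j => L.place (.inr (j, L.entry (L.b i₀) j)))
    have h2 : ((Finset.univ.erase i₀).image L.a).card ≤ _ := Finset.card_image_le
    have h3 : (Finset.univ.image fun j => L.place (.inr (j, L.entry (L.b i₀) j))).card ≤ _ :=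
      Finset.card_image_le
    rw [Finset.card_erase_of_mem (Finset.mem_univ _), Finset.card_univ] at h2
    rw [Finset.card_univ] at h3
    have := Fintype.card_pos_iff.2 ⟨i₀⟩
    omega
  -- With root `b i₀`, the vertex `a i₀` is not needed: domination of $A\cup X$ only uses entries of
  -- pieces, and the piece of the root is not entered at `a i₀`.
  · have ha : ∀ i, L.b i₀ ≠ L.b i → i ∈ ((Finset.univ.erase i₀ : Finset R) : Set R) :=
      fun i hi => by simpa using fun h => hi (by rw [h])
    rw [Finset.coe_union, Finset.coe_image, Finset.coe_image]
    rcases L.covers hT (L.b i₀) (D := L.a '' ((Finset.univ.erase i₀ : Finset R) : Set R) ∪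
      (fun j => L.place (.inr (j, L.entry (L.b i₀) j))) '' ((Finset.univ : Finset S) : Set S))
      (fun i hi => Set.mem_union_left _ ⟨i, ha i hi, rfl⟩)
      (fun j _ => Set.mem_union_right _ ⟨j, by simp, rfl⟩) h with h | h | ⟨i, hi, h⟩ | ⟨j, hj, -⟩
    · exact Or.inl h
    · exact Or.inr (Or.inl h)
    · obtain rfl : i₀ = i := by simpa [L.place_eq_iff] using hi
      exact Or.inr (Or.inr h)
    · simp [L.place_eq_iff] at hj

/-- One vertex per piece other than that of `y j₀` suffices
to cover all edges except `y j₀, z j₀`. -/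
theorem exists_cover_y (L : Labelling T R S) (hT : T.IsTree) (j₀ : S) :
    ∃ D : Finset V, D.card + 1 ≤ Fintype.card R + Fintype.card S ∧
      ∀ u v, T.Adj u v → u ∈ closedNbhd T D ∨ v ∈ closedNbhd T D ∨
        s(u, v) = s(L.y j₀, L.z j₀) := by
  classical
  refine ⟨Finset.univ.image L.a ∪
    (Finset.univ.erase j₀).image fun j => L.place (.inr (j, L.entry (L.y j₀) j)), ?_,
    fun u v h => ?_⟩
  · have h1 := Finset.card_union_le (Finset.univ.image L.a)
      ((Finset.univ.erase j₀).image fun j => L.place (.inr (j, L.entry (L.y j₀) j)))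
    have h2 : (Finset.univ.image L.a).card ≤ _ := Finset.card_image_le
    have h3 : ((Finset.univ.erase j₀).image
      fun j => L.place (.inr (j, L.entry (L.y j₀) j))).card ≤ _ := Finset.card_image_le
    rw [Finset.card_erase_of_mem (Finset.mem_univ _), Finset.card_univ] at h3
    rw [Finset.card_univ] at h2
    have := Fintype.card_pos_iff.2 ⟨j₀⟩
    omega
  · have hx : ∀ j, L.y j₀ ≠ L.y j → j ∈ ((Finset.univ.erase j₀ : Finset S) : Set S) :=
      fun j hj => by simpa using fun h => hj (by rw [h])
    rw [Finset.coe_union, Finset.coe_image, Finset.coe_image]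
    rcases L.covers hT (L.y j₀) (D := L.a '' ((Finset.univ : Finset R) : Set R) ∪
      (fun j => L.place (.inr (j, L.entry (L.y j₀) j))) ''
        ((Finset.univ.erase j₀ : Finset S) : Set S))
      (fun i _ => Set.mem_union_left _ ⟨i, by simp, rfl⟩)
      (fun j hj => Set.mem_union_right _ ⟨j, hx j hj, rfl⟩) h with h | h | ⟨i, hi, -⟩ | ⟨j, hj, h⟩
    · exact Or.inl h
    · exact Or.inr (Or.inl h)
    · simp [L.place_eq_iff] at hi
    · obtain rfl : j₀ = j := by simpa [L.place_eq_iff] using hj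
      exact Or.inr (Or.inr h)

/-- Arbitrary finite index types are enumerated by `Fin`. A vertex labelled $a$ or $x$ is no leaf
because it has a neighbour inside its piece and a further one. -/
theorem memFamily (L : Labelling T R S) (hT : T.IsTree) (h : 2 ≤ Fintype.card R) : MemFamily T := by
  let eR := (Fintype.equivFin R).symm
  let eS := (Fintype.equivFin S).symm
  let e : PieceVertex (Fintype.card R) (Fintype.card S) ≃ V :=
    ((eR.prodCongr (Equiv.refl _)).sumCongr (eS.prodCongr (Equiv.refl _))).trans
      (Equiv.ofBijective _ L.bijective)
  have el : ∀ i k, e (.inl (i, k)) = L.place (.inl (eR i, k)) := fun _ _ => rfl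
  have er : ∀ i k, e (.inr (i, k)) = L.place (.inr (eS i, k)) := fun _ _ => rfl
  have hin : ∀ u, IsLink u → ∃ p, L.Inner (e u) p := by
    rintro (⟨i, k⟩ | ⟨j, k⟩) hu
    · obtain rfl : k = 0 := hu
      exact ⟨_, Or.inl ⟨_, rfl, rfl⟩⟩
    · rcases hu with rfl | rfl
      · exact ⟨_, Or.inr (Or.inl ⟨_, rfl, rfl⟩)⟩
      · exact ⟨_, Or.inr (Or.inr ⟨_, rfl, rfl⟩)⟩
  have hnl : ∀ u v, T.Adj (e u) (e v) → ¬ IsLink u →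
      (pieces (Fintype.card R) (Fintype.card S)).Adj u v := by
    rintro (⟨i, k⟩ | ⟨j, k⟩) v huv hu
    · obtain rfl | rfl : k = 1 ∨ k = 2 := by
        simp only [IsLink] at hu
        omega
      · rcases (L.adj_b _ _).1 huv with h | h
        · obtain rfl : v = .inl (i, 0) := e.injective h
          simp [pieces_adj_inl]
        · obtain rfl : v = .inl (i, 2) := e.injective h
          simp [pieces_adj_inl]
      · obtain rfl : v = .inl (i, 1) := e.injective ((L.adj_c _ _).1 huv)
        simp [pieces_adj_inl]
    · obtain rfl | rfl : k = 1 ∨ k = 2 := by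
        simp only [IsLink] at hu
        omega
      · rcases (L.adj_y _ _).1 huv with h | h
        · obtain rfl : v = .inr (j, 0) := e.injective h
          simp [pieces_adj_inr]
        · obtain rfl : v = .inr (j, 2) := e.injective h
          simp [pieces_adj_inr]
      · rcases (L.adj_z _ _).1 huv with h | h
        · obtain rfl : v = .inr (j, 1) := e.injective h
          simp [pieces_adj_inr]
        · obtain rfl : v = .inr (j, 3) := e.injective h
          simp [pieces_adj_inr]
  refine ⟨_, _, e, hT, h, ?_, fun u v huv => ?_, fun u hu => ?_⟩
  · rintro (⟨i, k⟩ | ⟨i, k⟩) (⟨j, l⟩ | ⟨j, l⟩) huv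
    · rw [pieces_adj_inl] at huv
      obtain ⟨rfl, huv⟩ := huv
      have h1 := L.adj_a_b (eR i)
      have h2 := (L.adj_c (eR i) _).2 rfl
      rw [el, el]
      fin_cases k <;> fin_cases l <;> first
      | exact h1
      | exact h1.symm
      | exact h2
      | exact h2.symm
      | simp at huv
    · simp [pieces] at huv
    · simp [pieces] at huv
    · rw [pieces_adj_inr] at huv
      obtain ⟨rfl, huv⟩ := huv
      have h1 := L.adj_x_y (eS i)
      have h2 := L.adj_y_z (eS i)
      have h3 := L.adj_t_z (eS i)
      rw [er, er]
      fin_cases k <;> fin_cases l <;> first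
      | exact h1
      | exact h1.symm
      | exact h2
      | exact h2.symm
      | exact h3
      | exact h3.symm
      | simp at huv
  · by_cases hu : IsLink u
    · by_cases hv : IsLink v
      · exact Or.inr ⟨hu, hv⟩
      · exact Or.inl (hnl v u huv.symm hv).symm
    · exact Or.inl (hnl u v huv hu)
  · obtain ⟨p, hp⟩ := hin u hu
    exact L.not_isLeaf_of_inner hp

end Labelling

/-! ### Extending a labelling of a subtree -/

namespace Labelling

variable {V : Type*} {T : SimpleGraph V} {S₀ : Set V} {R S : Type}

/-- Counting gives injectivity for free, so only coverage has to be checked for the new placements.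
-/
theorem bijective_of_card [Finite V] {X : Type} [Finite X] {n : ℕ} {f : X → V}
    (hf : Function.Surjective f) (hX : Nat.card X = Nat.card S₀ + n)
    (hV : Nat.card V = Nat.card S₀ + n) : Function.Bijective f :=
  (Nat.bijective_iff_surjective_and_card f).2 ⟨hf, hX.trans hV.symm⟩

theorem card_eq_of_induce [Finite R] [Finite S] (L : Labelling (T.induce S₀) R S) :
    Nat.card S₀ = 3 * Nat.card R + 4 * Nat.card S := by
  rw [← Nat.card_congr (Equiv.ofBijective _ L.bijective)]
  simp [Nat.card_sum, Nat.card_prod, mul_comm]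

theorem adj_iff_eq_of_induce {u : V} {s q : S₀}
    (hS : ∀ w ∈ S₀, w ≠ u → ∀ z, T.Adj w z → z ∈ S₀) (hs : (s : V) ≠ u)
    (h : ∀ z : S₀, (T.induce S₀).Adj s z ↔ z = q) (z : V) : T.Adj s z ↔ z = q := by
  constructor
  · intro hz
    exact congrArg Subtype.val ((h ⟨z, hS s s.2 hs z hz⟩).1 hz)
  · rintro rfl
    exact (h q).2 rfl

theorem adj_iff_eq_or_of_induce {u : V} {s q q' : S₀}
    (hS : ∀ w ∈ S₀, w ≠ u → ∀ z, T.Adj w z → z ∈ S₀) (hs : (s : V) ≠ u)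
    (h : ∀ z : S₀, (T.induce S₀).Adj s z ↔ z = q ∨ z = q') (z : V) :
    T.Adj s z ↔ z = q ∨ z = q' := by
  constructor
  · intro hz
    exact ((h ⟨z, hS s s.2 hs z hz⟩).1 hz).imp (congrArg Subtype.val) (congrArg Subtype.val)
  · rintro (rfl | rfl)
    · exact (h q).2 (Or.inl rfl)
    · exact (h q').2 (Or.inr rfl)

theorem exists_adj_of_induce {s p : S₀} (h : ∃ w, (T.induce S₀).Adj s w ∧ w ≠ p) :
    ∃ w, T.Adj s w ∧ w ≠ p := by
  obtain ⟨w, hw, hne⟩ := h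
  exact ⟨w, hw, fun h => hne (Subtype.ext h)⟩

/-- A labelling extends to a further pendant `P₃` that is attached to a vertex `u` labelled `a`
or `x`. -/
noncomputable def attach [Finite V] [Finite R] [Finite S] (L : Labelling (T.induce S₀) R S)
    {u v p w : V} {hu : u ∈ S₀} {q : S₀} (hq : L.Inner ⟨u, hu⟩ q)
    (hcov : ∀ z, z ∈ S₀ ∨ z = v ∨ z = p ∨ z = w) (hcard : Nat.card V = Nat.card S₀ + 3)
    (hS : ∀ w ∈ S₀, w ≠ u → ∀ z, T.Adj w z → z ∈ S₀) (hup : u ≠ p)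
    (hv : ∀ z, T.Adj v z ↔ z = p ∨ z = u) (hp : ∀ z, T.Adj p z ↔ z = v ∨ z = w)
    (hw : ∀ z, T.Adj w z ↔ z = p) : Labelling T (Option R) S where
  place
    | .inl (none, k) => ![v, p, w] k
    | .inl (some i, k) => L.place (.inl (i, k))
    | .inr (j, k) => L.place (.inr (j, k))
  bijective := by
    refine bijective_of_card (S₀ := S₀) (n := 3) ?_ ?_ hcard
    · intro z
      rcases hcov z with hz | rfl | rfl | rfl
      · obtain ⟨⟨i, k⟩ | ⟨j, k⟩, h⟩ := L.bijective.2 ⟨z, hz⟩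
        · exact ⟨.inl (some i, k), congrArg Subtype.val h⟩
        · exact ⟨.inr (j, k), congrArg Subtype.val h⟩
      · exact ⟨.inl (none, 0), rfl⟩
      · exact ⟨.inl (none, 1), rfl⟩
      · exact ⟨.inl (none, 2), rfl⟩
    · rw [L.card_eq_of_induce]
      simp [Nat.card_sum, Nat.card_prod]
      ring
  adj_b
    | none, z => by simpa using hp z
    | some i, z => by
      -- Only `u` gains neighbours, and `u` is labelled $a$ or $x$, so the neighbourhoods of the
      -- other labels are unchanged.
      refine adj_iff_eq_or_of_induce hS (fun h => ?_) (L.adj_b i) z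
      · have : L.b i = ⟨u, hu⟩ := Subtype.ext h
        rcases hq with ⟨i, h, -⟩ | ⟨i, h, -⟩ | ⟨i, h, -⟩ <;> rw [h] at this <;>
          simp [L.place_eq_iff] at this
  adj_c
    | none, z => by simpa using hw z
    | some i, z => by
      refine adj_iff_eq_of_induce hS (fun h => ?_) (L.adj_c i) z
      · have : L.c i = ⟨u, hu⟩ := Subtype.ext h
        rcases hq with ⟨i, h, -⟩ | ⟨i, h, -⟩ | ⟨i, h, -⟩ <;> rw [h] at this <;>
          simp [L.place_eq_iff] at this
  adj_y i z := by
    refine adj_iff_eq_or_of_induce hS (fun h => ?_) (L.adj_y i) z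
    · have : L.y i = ⟨u, hu⟩ := Subtype.ext h
      rcases hq with ⟨i, h, -⟩ | ⟨i, h, -⟩ | ⟨i, h, -⟩ <;> rw [h] at this <;>
        simp [L.place_eq_iff] at this
  adj_z i z := by
    refine adj_iff_eq_or_of_induce hS (fun h => ?_) (L.adj_z i) z
    · have : L.z i = ⟨u, hu⟩ := Subtype.ext h
      rcases hq with ⟨i, h, -⟩ | ⟨i, h, -⟩ | ⟨i, h, -⟩ <;> rw [h] at this <;>
        simp [L.place_eq_iff] at this
  exists_a
    | none => ⟨u, (hv u).2 (Or.inr rfl), hup⟩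
    | some i => exists_adj_of_induce (L.exists_a i)
  exists_x j := exists_adj_of_induce (L.exists_x j)
  exists_t j := exists_adj_of_induce (L.exists_t j)

open Classical in
/-- If a path `u, v, p, w` is attached to the leaf `c i₀`, then the labelled `P₃` together with `u`
becomes a `P₄`, and `v, p, w` replaces that `P₃`. -/
noncomputable def attachLeaf [Finite V] [Finite R] [Finite S] (L : Labelling (T.induce S₀) R S)
    (i₀ : R) {u v p w : V} (huS : u ∉ S₀)
    (hcov : ∀ z, z ∈ S₀ ∨ z = u ∨ z = v ∨ z = p ∨ z = w) (hcard : Nat.card V = Nat.card S₀ + 4)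
    (hS : ∀ w ∈ S₀, w ≠ L.c i₀ → ∀ z, T.Adj w z → z ∈ S₀) (hup : u ≠ p) (hvS : v ∉ S₀)
    (hpS : p ∉ S₀) (hwS : w ∉ S₀)
    (hu : ∀ z, T.Adj u z ↔ z = v ∨ z = L.c i₀)
    (hv : ∀ z, T.Adj v z ↔ z = p ∨ z = u) (hp : ∀ z, T.Adj p z ↔ z = v ∨ z = w)
    (hw : ∀ z, T.Adj w z ↔ z = p) : Labelling T R (Option S) where
  place
    | .inl (i, k) => if i = i₀ then ![v, p, w] k else L.place (.inl (i, k))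
    | .inr (none, k) => ![(L.a i₀ : V), L.b i₀, L.c i₀, u] k
    | .inr (some j, k) => L.place (.inr (j, k))
  bijective := by
    refine bijective_of_card (S₀ := S₀) (n := 4) ?_ ?_ hcard
    · intro z
      rcases hcov z with hz | rfl | rfl | rfl | rfl
      · obtain ⟨⟨i, k⟩ | ⟨j, k⟩, h⟩ := L.bijective.2 ⟨z, hz⟩
        · by_cases hi : i = i₀
          · subst hi
            have h : (L.place (.inl (i, k)) : V) = z := congrArg Subtype.val h
            fin_cases k
            · exact ⟨.inr (none, 0), h⟩
            · exact ⟨.inr (none, 1), h⟩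
            · exact ⟨.inr (none, 2), h⟩
          · exact ⟨.inl (i, k), by simpa [hi] using congrArg Subtype.val h⟩
        · exact ⟨.inr (some j, k), congrArg Subtype.val h⟩
      · exact ⟨.inr (none, 3), rfl⟩
      · exact ⟨.inl (i₀, 0), by simp⟩
      · exact ⟨.inl (i₀, 1), by simp⟩
      · exact ⟨.inl (i₀, 2), by simp⟩
    · rw [L.card_eq_of_induce]
      simp [Nat.card_sum, Nat.card_prod]
      ring
  adj_b i z := by
    by_cases hi : i = i₀
    · simpa [hi] using hp z
    · simp only [hi, if_false]
      refine adj_iff_eq_or_of_induce hS (fun h => ?_) (L.adj_b i) z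
      · simpa [L.place_eq_iff] using Subtype.ext h
  adj_c i z := by
    by_cases hi : i = i₀
    · simpa [hi] using hw z
    · simp only [hi, if_false]
      refine adj_iff_eq_of_induce hS (fun h => ?_) (L.adj_c i) z
      · exact hi (by simpa [L.place_eq_iff] using Subtype.ext h)
  adj_y
    | none, z => by
      refine adj_iff_eq_or_of_induce hS (fun h => ?_) (L.adj_b i₀) z
      · simpa [L.place_eq_iff] using Subtype.ext h
    | some j, z => by
      refine adj_iff_eq_or_of_induce hS (fun h => ?_) (L.adj_y j) z
      · simpa [L.place_eq_iff] using Subtype.ext h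
  adj_z
    | none, z => by
      change T.Adj (L.c i₀) z ↔ z = (L.b i₀ : V) ∨ z = u
      by_cases hz : z ∈ S₀
      · have h1 : z ≠ u := fun h => huS (h ▸ hz)
        have := L.adj_c i₀ ⟨z, hz⟩
        simpa [Subtype.ext_iff, h1] using this
      -- The neighbourhoods of `v`, `p`, `w` avoid `S₀`, so `u` is the only possible neighbour of `c
      -- i₀` outside `S₀`.
      · have h1 : z ≠ (L.b i₀ : V) := fun h => hz (h ▸ Subtype.prop _)
        have hc : ∀ {x}, x ∉ S₀ → (L.c i₀ : V) ≠ x := fun hx h => hx (h ▸ Subtype.prop _)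
        simp only [h1, false_or]
        constructor
        · intro h
          rcases hcov z with h' | rfl | rfl | rfl | rfl
          · exact absurd h' hz
          · rfl
          · rcases (hv _).1 h.symm with h | h
            · exact absurd h (hc hpS)
            · exact absurd h (hc huS)
          · rcases (hp _).1 h.symm with h | h
            · exact absurd h (hc hvS)
            · exact absurd h (hc hwS)
          · exact absurd ((hw _).1 h.symm) (hc hpS)
        · rintro rfl
          exact ((hu _).2 (Or.inr rfl)).symm
    | some j, z => by
      refine adj_iff_eq_or_of_induce hS (fun h => ?_) (L.adj_z j) z
      · simpa [L.place_eq_iff] using Subtype.ext h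
  exists_a i := by
    by_cases hi : i = i₀
    · simp only [hi, if_true]
      exact ⟨u, (hv u).2 (Or.inr rfl), hup⟩
    · simp only [hi, if_false]
      exact exists_adj_of_induce (L.exists_a i)
  exists_x
    | none => exists_adj_of_induce (L.exists_a i₀)
    | some j => exists_adj_of_induce (L.exists_x j)
  exists_t
    | none => ⟨v, (hu v).2 (Or.inl rfl), fun h => hvS (h ▸ Subtype.prop _)⟩
    | some j => exists_adj_of_induce (L.exists_t j)

/-- The path of order 6 consists of two copies of `P₃` joined at their vertices labelled `a`. -/
noncomputable def ofPathSix [Finite V] {u v p w t t' : V}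
    (hcov : ∀ z, z = u ∨ z = v ∨ z = p ∨ z = w ∨ z = t ∨ z = t') (hcard : Nat.card V = 6)
    (hup : u ≠ p) (hvt : v ≠ t)
    (hu : ∀ z, T.Adj u z ↔ z = v ∨ z = t)
    (hv : ∀ z, T.Adj v z ↔ z = p ∨ z = u) (hp : ∀ z, T.Adj p z ↔ z = v ∨ z = w)
    (hw : ∀ z, T.Adj w z ↔ z = p) (ht : ∀ z, T.Adj t z ↔ z = u ∨ z = t')
    (ht' : ∀ z, T.Adj t' z ↔ z = t) : Labelling T (Fin 2) Empty where
  place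
    | .inl (i, k) => ![![v, p, w], ![u, t, t']] i k
    | .inr (j, _) => j.elim
  bijective := by
    refine (Nat.bijective_iff_surjective_and_card _).2 ⟨fun z => ?_, ?_⟩
    · rcases hcov z with rfl | rfl | rfl | rfl | rfl | rfl
      · exact ⟨.inl (1, 0), rfl⟩
      · exact ⟨.inl (0, 0), rfl⟩
      · exact ⟨.inl (0, 1), rfl⟩
      · exact ⟨.inl (0, 2), rfl⟩
      · exact ⟨.inl (1, 1), rfl⟩
      · exact ⟨.inl (1, 2), rfl⟩
    · rw [hcard]
      simp
  adj_b i z := by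
    fin_cases i
    · exact hp z
    · exact ht z
  adj_c i z := by
    fin_cases i
    · exact hw z
    · exact ht' z
  adj_y j := j.elim
  adj_z j := j.elim
  exists_a i := by
    fin_cases i
    · exact ⟨u, (hv u).2 (Or.inr rfl), hup⟩
    · exact ⟨v, (hu v).2 (Or.inl rfl), hvt⟩
  exists_x j := j.elim
  exists_t j := j.elim

end Labelling

/-! ### Branches that are stars -/

section Star

variable {V : Type*} {T : SimpleGraph V}

/-- A branch is left only through the edge between its root `u` and `v`. -/
theorem mem_side_of_adj_of_ne (hT : T.IsAcyclic) {u v z y : V} (h : T.Adj v u)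
    (hz : z ∈ side T v u) (hne : z ≠ u) (hzy : T.Adj z y) : y ∈ side T v u := by
  refine mem_side_of_adj hz hzy ?_
  rintro rfl
  exact hne (eq_of_adj_of_mem_side hT h hzy.symm hz)

/-- Another neighbour of `w` would lie in the same star and form a triangle with `p` and `w`. -/
theorem adj_iff_of_side_star (hT : T.IsAcyclic) {v p w : V} (hp : T.Adj v p)
    (hstar : ∀ w ∈ side T v p, w = p ∨ T.Adj p w) (hw : w ∈ side T v p) (hne : w ≠ p) (z : V) :
    T.Adj w z ↔ z = p := by
  have hpw := (hstar w hw).resolve_left hne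
  refine ⟨fun hz => ?_, fun h => h ▸ hpw.symm⟩
  have hzs := mem_side_of_adj_of_ne hT hp hw hne hz
  exact (hstar z hzs).resolve_right fun h => not_adj_of_adj_of_adj hT hpw h hz

theorem exists_isLeaf_of_side_star (hT : T.IsAcyclic) {v p : V} (hp : T.Adj v p)
    (hstar : ∀ w ∈ side T v p, w = p ∨ T.Adj p w) : ∃ w ∈ side T v p, IsLeaf T w := by
  by_cases h : ∃ w ∈ side T v p, w ≠ p
  · obtain ⟨w, hw, hne⟩ := h
    exact ⟨w, hw, isLeaf_iff.2 ⟨p, adj_iff_of_side_star hT hp hstar hw hne⟩⟩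
  · push Not at h
    refine ⟨p, mem_side_self hp.ne, isLeaf_iff.2 ⟨v, fun z => ⟨fun hz => ?_, ?_⟩⟩⟩
    · by_contra hzv
      exact hz.ne (h z (mem_side_of_adj (mem_side_self hp.ne) hz hzv)).symm
    · rintro rfl
      exact hp.symm

/-- A tree in which some side of an edge is not a star contains such a side all of whose
branches are stars. -/
theorem exists_side_of_not_star [Finite V] (hT : T.IsTree) {u v w : V} (huv : T.Adj u v)
    (hw : w ∈ side T u v) (hne : w ≠ v) (hadj : ¬ T.Adj v w) :
    ∃ u v w, T.Adj u v ∧ w ∈ side T u v ∧ w ≠ v ∧ ¬ T.Adj v w ∧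
      ∀ p, T.Adj v p → p ≠ u → ∀ z ∈ side T v p, z = p ∨ T.Adj p z := by
  induction hn : (side T u v).ncard using Nat.strong_induction_on generalizing u v w with
  | _ n ih =>
    by_cases h : ∀ p, T.Adj v p → p ≠ u → ∀ z ∈ side T v p, z = p ∨ T.Adj p z
    · exact ⟨u, v, w, huv, hw, hne, hadj, h⟩
    · push Not at h
      obtain ⟨p, hp, hpu, z, hz, hzp, hpz⟩ := h
      -- Descend into the branch that is not a star; it is strictly smaller because it omits `v`.
      refine ih _ ?_ hp hz hzp hpz rfl
      rw [← hn]
      refine Set.ncard_lt_ncard ⟨side_subset_side hT.isAcyclic hp huv.symm hpu, fun h => ?_⟩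
      exact notMem_side v p (h (mem_side_self huv.ne))

/-- For each edge, `r` lies on one of its two sides, and that side is a star centred at an end of
the edge; this end is `r` or adjacent to `r`. -/
theorem isIsolating_singleton (hT : T.IsTree)
    (h : ∀ u v, T.Adj u v → ∀ w ∈ side T u v, w = v ∨ T.Adj v w) (r : V) :
    IsIsolating T {r} := by
  rw [isIsolating_iff]
  have key : ∀ u v, T.Adj u v → r ∈ side T u v → v ∈ closedNbhd T {r} := by
    intro u v huv hr
    rcases h u v huv r hr with rfl | hvr
    · exact Or.inl rfl
    · exact Or.inr ⟨r, rfl, hvr.symm⟩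
  intro u v huv
  rcases mem_side_or hT huv r with hr | hr
  · exact Or.inr (key _ _ huv hr)
  · exact Or.inl (key _ _ huv.symm hr)

theorem isLeaf_of_card_eq_two [Finite V] (hT : T.IsTree) (h : Nat.card V = 2) (v : V) :
    IsLeaf T v := by
  have := Fintype.ofFinite V
  have h2 := two_le_leafOrder hT (by rw [← Nat.card_eq_fintype_card, h])
  have := Set.eq_of_subset_of_ncard_le (Set.subset_univ {v | IsLeaf T v})
    (by rw [Set.ncard_univ, h]; exact h2)
  have hv : v ∈ {v | IsLeaf T v} := by rw [this]; exact Set.mem_univ v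
  exact hv

theorem card_eq_card_add_ncard_compl [Finite V] (S : Set V) :
    Nat.card V = Nat.card S + Sᶜ.ncard := by
  rw [← Set.ncard_add_ncard_compl S, Nat.card_coe_set_eq]

end Star

/-! ### The extremal bound and its equality cases -/

/-- The label of `u` in the smaller tree decides. For $a$ or $x$ the path `v`, `p`, `w` is a further
$P_3$; $c$ is excluded since `u` is not a leaf there. For $b$ or $y$, a set one vertex short covers
all edges but one at `u`, and adding `v` covers that edge too, so the isolation number would not
grow, against `hι`. -/
theorem memFamily_of_attach {V : Type*} [Finite V] {T : SimpleGraph V} (hT : T.IsTree)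
    {S₀ : Set V} {u v p w : V} (hu : u ∈ S₀) (huv : T.Adj u v)
    (hcov : ∀ z, z ∈ S₀ ∨ z = v ∨ z = p ∨ z = w) (hcard : Nat.card V = Nat.card S₀ + 3)
    (hS : ∀ w ∈ S₀, w ≠ u → ∀ z, T.Adj w z → z ∈ S₀) (hup : u ≠ p)
    (hv : ∀ z, T.Adj v z ↔ z = p ∨ z = u) (hp : ∀ z, T.Adj p z ↔ z = v ∨ z = w)
    (hw : ∀ z, T.Adj w z ↔ z = p)
    (hE : ∀ w z, T.Adj w z → w ∉ S₀ →
      w ∈ closedNbhd T (({v} : Finset V) : Set V) ∨ z ∈ closedNbhd T (({v} : Finset V) : Set V))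
    (hS₀ : (T.induce S₀).IsTree) (hleaf : ¬ IsLeaf (T.induce S₀) ⟨u, hu⟩)
    (hfam : MemFamily (T.induce S₀))
    (hι : isolationNumber (T.induce S₀) + 1 ≤ isolationNumber T) : MemFamily T := by
  have := Fintype.ofFinite V
  have := Fintype.ofFinite S₀
  obtain ⟨r, s, e, h⟩ := hfam
  have hL := h.labelling.card_le_isolationNumber
  have hinner : ∀ q, h.labelling.Inner ⟨u, hu⟩ q → MemFamily T := fun q hq => by
    refine (h.labelling.attach hq hcov hcard hS hup hv hp hw).memFamily hT ?_
    have := h.two_le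
    simp
    omega
  have huE : u ∈ closedNbhd T (({v} : Finset V) : Set V) := Or.inr ⟨v, by simp, huv.symm⟩
  have hcover : ∀ q q' : S₀, (q = ⟨u, hu⟩ ∨ q' = ⟨u, hu⟩) →
      (∃ D : Finset S₀, D.card + 1 ≤ Fintype.card (Fin r) + Fintype.card (Fin s) ∧
        ∀ a b, (T.induce S₀).Adj a b → a ∈ closedNbhd (T.induce S₀) D ∨
          b ∈ closedNbhd (T.induce S₀) D ∨ s(a, b) = s(q, q')) → MemFamily T := by
    rintro q q' hq ⟨D, hD, hc⟩
    have := isolationNumber_le_card_add (G := T) (D := D) (E := {v}) (fun a b hab => by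
      refine (hc a b hab).imp id fun h => h.imp id fun h => ?_
      rcases Sym2.eq_iff.1 h with ⟨rfl, rfl⟩ | ⟨rfl, rfl⟩ <;> rcases hq with rfl | rfl
      · exact Or.inl huE
      · exact Or.inr huE
      · exact Or.inr huE
      · exact Or.inl huE) hE
    rw [Finset.card_singleton] at this
    omega
  rcases h.labelling.cover ⟨u, hu⟩ with ⟨k, hk⟩ | ⟨k, hk⟩ | hk | ⟨k, hk⟩ | ⟨k, hk⟩ | ⟨k, hk⟩ | ⟨k, hk⟩
  · exact hinner _ (Or.inl ⟨k, hk, rfl⟩)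
  · exact hcover _ _ (Or.inl hk.symm) (h.labelling.exists_cover_b hS₀ k)
  · exact absurd (h.labelling.isLeaf_iff_eq_c.2 hk) hleaf
  · exact hinner _ (Or.inr (Or.inl ⟨k, hk, rfl⟩))
  · exact hcover _ _ (Or.inl hk.symm) (h.labelling.exists_cover_y hS₀ k)
  · exact hcover _ _ (Or.inr hk.symm) (h.labelling.exists_cover_y hS₀ k)
  · exact hinner _ (Or.inr (Or.inr ⟨k, hk, rfl⟩))

/-- The conclusion of the extremal theorem for a tree: the bound `4 ι ≤ n + ℓ`, with equality only
for `K₂` and members of the family. -/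
def Bounded {V : Type*} (T : SimpleGraph V) : Prop :=
  4 * isolationNumber T ≤ Nat.card V + leafOrder T ∧
    (4 * isolationNumber T = Nat.card V + leafOrder T → Nat.card V = 2 ∨ MemFamily T)

section Bound

variable {V : Type*} [Finite V] {T : SimpleGraph V}

theorem bounded_of_side_star (hT : T.IsTree)
    (h : ∀ u v, T.Adj u v → ∀ w ∈ side T u v, w = v ∨ T.Adj v w) : Bounded T := by
  have := Fintype.ofFinite V
  obtain ⟨r⟩ := hT.connected.nonempty
  have h1 := isolationNumber_le (D := {r}) (G := T)
    (by simpa using isIsolating_singleton hT h r)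
  rw [Finset.card_singleton] at h1
  unfold Bounded
  by_cases hc : 2 ≤ Fintype.card V
  · have h2 := two_le_leafOrder hT hc
    rw [Nat.card_eq_fintype_card]
    exact ⟨by omega, fun h => Or.inl (by omega)⟩
  · have : Subsingleton V := Fintype.card_le_one_iff_subsingleton.1 (by omega)
    -- For a single vertex the bound $\iota\le 1$ is too weak; the empty set isolates.
    have h0 := isolationNumber_le (D := ∅) (G := T)
      (isIsolating_iff.2 fun u v huv => absurd (Subsingleton.elim u v) huv.ne)
    rw [Finset.card_empty] at h0
    have : 0 < Nat.card V := Nat.card_pos_iff.2 ⟨⟨r⟩, inferInstance⟩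
    exact ⟨by omega, fun h => by omega⟩

/-- The step of the induction in which a path `v, p, w` is attached at a vertex `u` of degree at
most two. -/
theorem bounded_of_pendant_path_leaf (hT : T.IsTree) {u v p w t : V}
    (ih : ∀ S : Set V, Nat.card S < Nat.card V → (T.induce S).IsTree → Bounded (T.induce S))
    (hup : u ≠ p) (hvt : v ≠ t) (hwu : w ≠ u)
    (hu : ∀ z, T.Adj u z ↔ z = v ∨ z = t)
    (hv : ∀ z, T.Adj v z ↔ z = p ∨ z = u) (hp : ∀ z, T.Adj p z ↔ z = v ∨ z = w)
    (hw : ∀ z, T.Adj w z ↔ z = p) : Bounded T := by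
  have := Fintype.ofFinite V
  have hac := hT.isAcyclic
  have hut : T.Adj u t := (hu t).2 (Or.inr rfl)
  have huv : T.Adj u v := (hu v).2 (Or.inl rfl)
  have hvp : T.Adj v p := (hv p).2 (Or.inl rfl)
  have hpw : T.Adj p w := (hp w).2 (Or.inr rfl)
  have hvw : v ≠ w := by
    rintro rfl
    exact hup ((hw u).1 huv.symm)
  set S := side T u t
  have hSt : (T.induce S).IsTree := isTree_induce_side hT hut.ne
  have htS : t ∈ S := mem_side_self hut.ne
  have hclosed : ∀ z ∈ S, z ≠ t → ∀ y, T.Adj z y → y ∈ S :=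
    fun z hz hne y => mem_side_of_adj_of_ne hac hut hz hne
  have huS : u ∉ S := notMem_side u t
  have hvS : v ∉ S := fun h => hvt (eq_of_adj_of_mem_side hac hut huv h)
  have hpS : p ∉ S := fun h => hvS (mem_side_of_adj h hvp.symm huv.ne')
  have hwS : w ∉ S := fun h => hpS (mem_side_of_adj h hpw.symm hup.symm)
  -- The listed set contains `u` and is closed under adjacency, so by connectedness it is
  -- everything.
  have hcov : ∀ z, z ∈ S ∨ z = u ∨ z = v ∨ z = p ∨ z = w := by
    intro z
    have hreach : ∀ {x z}, T.Walk x z → (x ∈ S ∨ x = u ∨ x = v ∨ x = p ∨ x = w) →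
        (z ∈ S ∨ z = u ∨ z = v ∨ z = p ∨ z = w) := by
      intro x z q
      induction q with
      | nil => exact id
      | @cons a b _ hadj _ ih =>
        refine fun hx => ih ?_
        rcases hx with hx | rfl | rfl | rfl | rfl
        · by_cases hxt : a = t
          · subst hxt
            by_cases hyu : b = u
            · exact Or.inr (Or.inl hyu)
            · exact Or.inl (mem_side_of_adj hx hadj hyu)
          · exact Or.inl (hclosed _ hx hxt _ hadj)
        · rcases (hu _).1 hadj with rfl | rfl <;> simp [htS]
        · rcases (hv _).1 hadj with rfl | rfl <;> simp
        · rcases (hp _).1 hadj with rfl | rfl <;> simp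
        · rcases (hw _).1 hadj with rfl; simp
    exact hreach (hT.connected u z).some (Or.inr (Or.inl rfl))
  have hcompl : Sᶜ = {u, v, p, w} := by
    ext z
    simp only [Set.mem_compl_iff, Set.mem_insert_iff, Set.mem_singleton_iff]
    refine ⟨fun h => (hcov z).resolve_left h, ?_⟩
    rintro (rfl | rfl | rfl | rfl) <;> assumption
  have hcard : Nat.card V = Nat.card S + 4 := by
    rw [card_eq_card_add_ncard_compl S, hcompl, Set.ncard_insert_of_notMem,
      Set.ncard_insert_of_notMem, Set.ncard_pair hpw.ne]
    · simp [hvp.ne, hvw]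
    · simp [huv.ne, hup, hwu.symm]
  obtain ⟨hb, heq⟩ := ih S (by omega) hSt
  have hE : ∀ z y, T.Adj z y → z ∉ S → z ∈ closedNbhd T (({v} : Finset V) : Set V) ∨
      y ∈ closedNbhd T (({v} : Finset V) : Set V) := by
    intro z y hzy hz
    have hpN : p ∈ closedNbhd T (({v} : Finset V) : Set V) := Or.inr ⟨v, by simp, hvp⟩
    rcases (hcov z).resolve_left hz with rfl | rfl | rfl | rfl
    · exact Or.inl (Or.inr ⟨v, by simp, huv.symm⟩)
    · exact Or.inl (Or.inl (by simp))
    · exact Or.inl hpN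
    · exact Or.inr ((hw y).1 hzy ▸ hpN)
  have hι := isolationNumber_le_induce_add hE
  rw [Finset.card_singleton] at hι
  have hL : ∀ l ∈ ({w} : Finset V), l ∉ S ∧ IsLeaf T l := by
    intro l hl
    rw [Finset.mem_singleton] at hl
    subst hl
    exact ⟨hwS, isLeaf_iff.2 ⟨p, hw⟩⟩
  have hℓ := leafOrder_induce_add_le_add_one t (fun z : S => hclosed z z.2) hL
  rw [Finset.card_singleton] at hℓ
  refine ⟨by omega, fun h => Or.inr ?_⟩
  -- The order drops by 4, which pays for one isolating vertex, so equality allows no drop in the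
  -- number of leaves: `t` must replace the lost leaf `w`.
  have hleaf : IsLeaf (T.induce S) ⟨t, htS⟩ := by
    by_contra hnl
    have hℓ' := leafOrder_induce_add_le (G := T) (S := S)
      (fun z hz => hclosed z z.2 fun h => hnl (by
        have : z = ⟨t, htS⟩ := Subtype.ext h
        rwa [this] at hz)) hL
    rw [Finset.card_singleton] at hℓ'
    omega
  -- If only an edge remains, `T` is the path of order 6; otherwise `t` is labelled $c$ and its
  -- $P_3$ absorbs `u`.
  rcases heq (by omega) with h2 | ⟨r, s, e, hcons⟩
  · obtain ⟨t', ht', hun⟩ := (Nat.card_eq_two_iff' (⟨t, htS⟩ : S)).1 h2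
    have hone : ∀ z : S, z = ⟨t, htS⟩ ∨ z = t' := fun z => by
      by_cases hz : z = ⟨t, htS⟩
      · exact Or.inl hz
      · exact Or.inr (hun z hz)
    have ht't : (t' : V) ≠ t := fun h => ht' (Subtype.ext h)
    obtain ⟨x, hx⟩ := isLeaf_iff.1 hleaf
    have htx : T.Adj t x := (hx x).2 rfl
    obtain rfl : x = t' := (hone x).resolve_left fun h => htx.ne (congrArg Subtype.val h).symm
    have hht : ∀ z, T.Adj t z ↔ z = u ∨ z = x := by
      intro z
      constructor
      · intro hz
        by_cases hzu : z = u
        · exact Or.inl hzu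
        · exact Or.inr (congrArg Subtype.val ((hx ⟨z, mem_side_of_adj htS hz hzu⟩).1 hz))
      · rintro (rfl | rfl)
        · exact hut.symm
        · exact htx
    have hhx : ∀ z, T.Adj x z ↔ z = t := by
      intro z
      constructor
      · intro hz
        rcases hone ⟨z, hclosed x x.2 ht't z hz⟩ with h | h
        · exact congrArg Subtype.val h
        · exact absurd (congrArg Subtype.val h).symm hz.ne
      · rintro rfl
        exact htx.symm
    refine (Labelling.ofPathSix (t' := (x : V)) (fun z => ?_) (by omega) hup hvt hu hv hp hw
      hht hhx).memFamily hT (by simp)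
    rcases hcov z with h | h | h | h | h
    · rcases hone ⟨z, h⟩ with h | h
      · exact Or.inr (Or.inr (Or.inr (Or.inr (Or.inl (congrArg Subtype.val h)))))
      · exact Or.inr (Or.inr (Or.inr (Or.inr (Or.inr (congrArg Subtype.val h)))))
    all_goals simp [h]
  · obtain ⟨i, hi⟩ := hcons.labelling.isLeaf_iff_eq_c.1 hleaf
    have hi' : t = hcons.labelling.c i := congrArg Subtype.val hi
    rw [hi'] at hu hclosed
    refine (hcons.labelling.attachLeaf i huS hcov hcard hclosed hup hvS hpS hwS
      hu hv hp hw).memFamily hT ?_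
    simpa using hcons.two_le

/-- One isolating vertex `v` must be paid for by a decrease of at least 4 in $n+\ell$. Removing `v`,
`p`, `w` gives 3 plus the leaf `w`, unless `u` becomes a leaf; a larger remainder gives at least 4
vertices and a net loss of at least one leaf. -/
theorem bounded_of_induction (hT : T.IsTree)
    (ih : ∀ S : Set V, Nat.card S < Nat.card V → (T.induce S).IsTree → Bounded (T.induce S)) :
    Bounded T := by
  classical
  have := Fintype.ofFinite V
  have hac := hT.isAcyclic
  by_cases hall : ∀ u v, T.Adj u v → ∀ w ∈ side T u v, w = v ∨ T.Adj v w
  · exact bounded_of_side_star hT hall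
  push Not at hall
  obtain ⟨u, v, huv, w, hw, hwv, hvw⟩ := hall
  obtain ⟨u, v, w, huv, hw, hwv, hvw, hstar⟩ := exists_side_of_not_star hT huv hw hwv hvw
  set S := side T v u
  have hSt : (T.induce S).IsTree := isTree_induce_side hT huv.ne'
  have huS : u ∈ S := mem_side_self huv.ne'
  have hclosed : ∀ z ∈ S, z ≠ u → ∀ y, T.Adj z y → y ∈ S :=
    fun z hz hne y => mem_side_of_adj_of_ne hac huv.symm hz hne
  have hmem : ∀ {z}, z ∉ S ↔ z ∈ side T u v := notMem_side_iff hT huv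
  have hchild : ∀ {z}, z ∉ S → z ≠ v → ∃ p, T.Adj v p ∧ p ≠ u ∧ z ∈ side T v p := by
    intro z hz hzv
    obtain ⟨p, hp, hzp⟩ := exists_mem_side hT.connected hzv
    exact ⟨p, hp, fun h => hz (by rwa [h] at hzp), hzp⟩
  have hsub : ∀ {p}, T.Adj v p → p ≠ u → ∀ {z}, z ∈ side T v p → z ∉ S := fun hp hpu z hz =>
    hmem.2 (side_subset_side hac hp huv.symm hpu hz)
  have hwS : w ∉ S := hmem.2 hw
  have hvS : v ∉ S := notMem_side v u
  obtain ⟨p, hp, hpu, hwp⟩ := hchild hwS hwv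
  have hpS : p ∉ S := hsub hp hpu (mem_side_self hp.ne)
  have hwne : w ≠ p := fun h => hvw (h ▸ hp)
  have hadjw := adj_iff_of_side_star hac hp (hstar p hp hpu) hwp hwne
  have hwleaf : IsLeaf T w := isLeaf_iff.2 ⟨p, hadjw⟩
  -- Outside `S` every branch at `v` is a star whose centre is adjacent to `v`, so each edge has an
  -- end in $N[v]$.
  have hE : ∀ z y, T.Adj z y → z ∉ S → z ∈ closedNbhd T (({v} : Finset V) : Set V) ∨
      y ∈ closedNbhd T (({v} : Finset V) : Set V) := by
    intro z y hzy hz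
    by_cases hzv : z = v
    · exact Or.inl (Or.inl (by simp [hzv]))
    · obtain ⟨p', hp', hpu', hzp'⟩ := hchild hz hzv
      have hN : p' ∈ closedNbhd T (({v} : Finset V) : Set V) := Or.inr ⟨v, by simp, hp'⟩
      by_cases hne : z = p'
      · exact Or.inl (hne ▸ hN)
      · exact Or.inr
          ((adj_iff_of_side_star hac hp' (hstar p' hp' hpu') hzp' hne y).1 hzy ▸ hN)
  have hι := isolationNumber_le_induce_add hE
  rw [Finset.card_singleton] at hι
  have hcardS := card_eq_card_add_ncard_compl S
  have hlt : Nat.card S < Nat.card V := by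
    have : 0 < Sᶜ.ncard := (Set.ncard_pos (Set.toFinite _)).2 ⟨v, hvS⟩
    omega
  obtain ⟨hb, heq⟩ := ih S hlt hSt
  by_cases h3 : ∀ z, z ∉ S → z = v ∨ z = p ∨ z = w
  · have hcompl : Sᶜ = {v, p, w} := by
      ext z
      simp only [Set.mem_compl_iff, Set.mem_insert_iff, Set.mem_singleton_iff]
      refine ⟨h3 z, ?_⟩
      rintro (rfl | rfl | rfl) <;> assumption
    have hcard : Nat.card V = Nat.card S + 3 := by
      rw [hcardS, hcompl, Set.ncard_insert_of_notMem, Set.ncard_pair hwne.symm]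
      simp [hp.ne, hwv.symm]
    have hadjv : ∀ z, T.Adj v z ↔ z = p ∨ z = u := by
      intro z
      constructor
      · intro hz
        by_cases hzu : z = u
        · exact Or.inr hzu
        · rcases h3 z (hsub hz hzu (mem_side_self hz.ne)) with h | h | h
          · exact absurd h hz.ne'
          · exact Or.inl h
          · exact absurd (h ▸ hz) hvw
      · rintro (rfl | rfl)
        · exact hp
        · exact huv.symm
    have hadjp : ∀ z, T.Adj p z ↔ z = v ∨ z = w := by
      intro z
      constructor
      · intro hz
        by_cases hzv : z = v
        · exact Or.inl hzv
        · have := hsub hp hpu (mem_side_of_adj (mem_side_self hp.ne) hz hzv)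
          rcases h3 z this with h | h | h
          · exact Or.inl h
          · exact absurd h hz.ne'
          · exact Or.inr h
      · rintro (rfl | rfl)
        · exact hp.symm
        · exact ((hadjw p).2 rfl).symm
    by_cases hleaf : IsLeaf (T.induce S) ⟨u, huS⟩
    · obtain ⟨t, ht⟩ := isLeaf_iff.1 hleaf
      have hadju : ∀ z, T.Adj u z ↔ z = v ∨ z = t := by
        intro z
        constructor
        · intro hz
          by_cases hzv : z = v
          · exact Or.inl hzv
          · exact Or.inr (congrArg Subtype.val ((ht ⟨z, mem_side_of_adj huS hz hzv⟩).1 hz))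
        · rintro (rfl | rfl)
          · exact huv
          · exact (ht t).2 rfl
      exact bounded_of_pendant_path_leaf hT ih hpu.symm (fun h => hvS (by rw [h]; exact t.2))
        (fun h => hwS (by rw [h]; exact huS)) hadju hadjv hadjp hadjw
    · have hℓ := leafOrder_induce_add_le (G := T) (S := S) (L := {w})
        (fun z hz => hclosed z z.2 fun h => hleaf (by
          have : z = ⟨u, huS⟩ := Subtype.ext h
          rwa [this] at hz))
        (fun l hl => by
          rw [Finset.mem_singleton] at hl
          subst hl
          exact ⟨hwS, hwleaf⟩)
      rw [Finset.card_singleton] at hℓ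
      refine ⟨by omega, fun h => Or.inr ?_⟩
      -- In $K_2$ both vertices are leaves, which `u` is not.
      rcases heq (by omega) with h2 | hfam
      · exact absurd (isLeaf_of_card_eq_two hSt h2 _) hleaf
      · refine memFamily_of_attach hT huS huv (fun z => ?_) hcard hclosed hpu.symm hadjv hadjp
          hadjw hE hSt hleaf hfam (by omega)
        by_cases hz : z ∈ S
        · exact Or.inl hz
        · exact Or.inr (h3 z hz)
  · push Not at h3
    obtain ⟨z, hz, hzv, hzp, hzw⟩ := h3
    -- A fourth vertex provides a second leaf: in the star of `p` it is one itself, and any other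
    -- branch contains one.
    obtain ⟨l, hlS, hlw, hleaf⟩ : ∃ l, l ∉ S ∧ l ≠ w ∧ IsLeaf T l := by
      obtain ⟨p', hp', hpu', hzp'⟩ := hchild hz hzv
      by_cases hpp : p' = p
      · subst hpp
        exact ⟨z, hz, hzw, isLeaf_iff.2
          ⟨p', adj_iff_of_side_star hac hp (hstar p' hp hpu) hzp' hzp⟩⟩
      · obtain ⟨l, hl, hleaf⟩ := exists_isLeaf_of_side_star hac hp' (hstar p' hp' hpu')
        exact ⟨l, hsub hp' hpu' hl, fun h => hpp (side_unique hac hp' hp (h ▸ hl) hwp), hleaf⟩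
    have hℓ := leafOrder_induce_add_le_add_one (L := {w, l}) u (fun z : S => hclosed z z.2)
      (fun x hx => by
        rw [Finset.mem_insert, Finset.mem_singleton] at hx
        rcases hx with rfl | rfl
        · exact ⟨hwS, hwleaf⟩
        · exact ⟨hlS, hleaf⟩)
    rw [Finset.card_pair hlw.symm] at hℓ
    have h4 : 4 ≤ Sᶜ.ncard := by
      have : ({v, p, w, z} : Set V).ncard = 4 := by
        rw [Set.ncard_insert_of_notMem, Set.ncard_insert_of_notMem, Set.ncard_pair hzw.symm]
        · simp [hwne.symm, hzp.symm]
        · simp [hp.ne, hwv.symm, hzv.symm]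
      rw [← this]
      refine Set.ncard_le_ncard ?_
      rintro x (rfl | rfl | rfl | rfl) <;> assumption
    -- At least four vertices and, even if `u` becomes a leaf, one leaf are lost for one isolating
    -- vertex, so equality is impossible.
    refine ⟨by omega, fun h => by omega⟩

end Bound

theorem bounded_of_isTree {V : Type*} [Finite V] {T : SimpleGraph V} (hT : T.IsTree) :
    Bounded T := by
  induction hn : Nat.card V using Nat.strong_induction_on generalizing V with
  | _ n ih => exact bounded_of_induction hT fun S hS hSt => ih _ (hn ▸ hS) hSt rfl

end TreeIsolation

/-! ### The characterisation and the prescribed minimum isolating set -/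

theorem theorem3 {V : Type*} [Fintype V] (T : SimpleGraph V) (hT : T.IsTree) :
    (6 ≤ Fintype.card V →
      ((TreeIsolation.isolationNumber T : ℚ)
          = ((Fintype.card V : ℚ) + (TreeIsolation.leafOrder T : ℚ)) / 4 ↔
        TreeIsolation.MemFamily T)) ∧
    (TreeIsolation.MemFamily T →
      (TreeIsolation.isolationNumber T : ℚ)
          = ((Fintype.card V : ℚ) + (TreeIsolation.leafOrder T : ℚ)) / 4) ∧
    (∀ (r s : ℕ) (e : TreeIsolation.PieceVertex r s ≃ V),
      TreeIsolation.IsConstruction T r s e →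
      ∃ (D : Finset V) (f : Fin s → Fin 4), (∀ j, f j = 0 ∨ f j = 3) ∧
        TreeIsolation.IsMinimumIsolating T D ∧
        (D : Set V) = {v | ∃ i : Fin r, v = e (Sum.inl (i, 0))} ∪
          {v | ∃ j : Fin s, v = e (Sum.inr (j, f j))}) := by
  have heq : (TreeIsolation.isolationNumber T : ℚ)
      = ((Fintype.card V : ℚ) + (TreeIsolation.leafOrder T : ℚ)) / 4 ↔
      4 * TreeIsolation.isolationNumber T = Fintype.card V + TreeIsolation.leafOrder T := by
    rw [eq_div_iff (by norm_num), mul_comm]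
    exact_mod_cast Iff.rfl
  have hfam : TreeIsolation.MemFamily T →
      4 * TreeIsolation.isolationNumber T = Fintype.card V + TreeIsolation.leafOrder T := by
    rintro ⟨r, s, e, h⟩
    have : Nonempty (Fin r) := ⟨⟨0, by have := h.two_le; omega⟩⟩
    rw [h.labelling.isolationNumber_eq hT, h.labelling.leafOrder_eq, h.labelling.card_eq]
    ring
  refine ⟨fun hn => ⟨fun h => ?_, fun h => heq.2 (hfam h)⟩, fun h => heq.2 (hfam h), ?_⟩
  · have := (TreeIsolation.bounded_of_isTree hT).2
    rw [Nat.card_eq_fintype_card] at this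
    exact (this (heq.1 h)).resolve_left (by omega)
  · intro r s e h
    have i₀ : Fin r := ⟨0, by have := h.two_le; omega⟩
    have : Nonempty (Fin r) := ⟨i₀⟩
    obtain ⟨D, hD, hc⟩ := h.labelling.exists_finset (h.labelling.b i₀)
    have hiso : TreeIsolation.IsIsolating T (D : Set V) := by
      refine h.labelling.isIsolating_entry hT (i₀ := i₀) (fun i => ?_) fun j => ?_
      · rw [hD]; exact Or.inl ⟨i, rfl⟩
      · rw [hD]; exact Or.inr ⟨j, rfl⟩
    refine ⟨D, h.labelling.entry (h.labelling.b i₀), h.labelling.entry_eq _,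
      ⟨hiso, le_antisymm ?_ (TreeIsolation.isolationNumber_le hiso)⟩, hD⟩
    -- The upper bound on the size of `D` suffices, because $r+s$ is also a lower bound for
    -- $\iota(T)$.
    exact hc.trans h.labelling.card_le_isolationNumber
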